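/- Let $q$ be an odd prime power, let $V$ be a $7$-dimensional $\mathbb F_q$-vector space with a nonsingular quadratic form $\mathfrak b$ of square discriminant (the discriminant of a form is the determinant of its Gram matrix in some basis, well defined modulo squares in $\mathbb F_q^\times$), and set $\mathrm{Spin}_7(q)=\mathrm{Spin}(V,\mathfrak b)$, acting on $V$ through $\mathrm{SO}(V,\mathfrak b)$. Let $z=-1\in \mathrm{Spin}_7(q)$ be the central involution, and fix a Sylow $2$-subgroup $S$ of $\mathrm{Spin}_7(q)$. An elementary abelian $2$-subgroup of $\mathrm{Spin}_7(q)$ has type I if all eigenspaces for its action on $V$ have square discriminant, and type II otherwise. Let $\mathcal E_4^{\mathrm I}$ and $\mathcal E_4^{\mathrm{II}}$ be the sets of elementary abelian $2$-subgroups of $S$ of rank $4$ that contain $z$ and are of type I, respectively II. Fix $U_0\in\mathcal E_4^{\mathrm I}$, let $\mathcal E_4^{\mathrm{Ia}}$ be the set of all members of $\mathcal E_4^{\mathrm I}$ that are $\mathrm{Spin}_7(q)$-conjugate to $U_0$, and put $\mathcal E_4^{\mathrm{Ib}}=\mathcal E_4^{\mathrm I}\smallsetminus\mathcal E_4^{\mathrm{Ia}}$.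 Let $\psi^q$ be the Frobenius automorphism of $\mathrm{Spin}_7(\overline{\mathbb F}_q)=\mathrm{Spin}(\overline{\mathbb F}_q\otimes V,\mathfrak b)\supseteq\mathrm{Spin}_7(q)$. Let $U\in\mathcal E_4^{\mathrm{Ib}}\cup\mathcal E_4^{\mathrm{II}}$. Then there is an element $g\in\mathrm{Spin}_7(\overline{\mathbb F}_q)$ such that ${}^gU=gUg^{-1}\in\mathcal E_4^{\mathrm{Ia}}$, and the element $\boldsymbol x(U)=g^{-1}\psi^q(g)$ lies in $U$ and is the same for all such $g$. Moreover, for every subgroup $E\le U$ of rank $3$ that contains $z$, the subgroup $E$ has type I if $\boldsymbol x(U)\in E$, and type II if $\boldsymbol x(U)\notin E$. -/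

import Mathlib

open scoped TensorProduct

noncomputable section

namespace SpinSeven

/-! ### Functoriality of spin groups -/

section Functoriality

variable {R M R' M' : Type*} [CommRing R] [AddCommGroup M] [Module R M]
  [CommRing R'] [AddCommGroup M'] [Module R' M']
  {Q : QuadraticForm R M} {Q' : QuadraticForm R' M'}

/-- A ring homomorphism of Clifford algebras that sends scalars to scalars and vectors to vectors
commutes with the canonical involution. -/
theorem map_star_of_mapsTo (f : CliffordAlgebra Q →+* CliffordAlgebra Q')
    (hs : ∀ r : R, ∃ r' : R', f (algebraMap R _ r) = algebraMap R' _ r')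
    (hv : ∀ m : M, ∃ m' : M', f (CliffordAlgebra.ι Q m) = CliffordAlgebra.ι Q' m')
    (x : CliffordAlgebra Q) : f (star x) = star (f x) := by
  induction x using CliffordAlgebra.induction with
  | algebraMap r =>
    obtain ⟨r', hr'⟩ := hs r
    rw [CliffordAlgebra.star_algebraMap, hr', CliffordAlgebra.star_algebraMap]
  | ι m =>
    obtain ⟨m', hm'⟩ := hv m
    rw [CliffordAlgebra.star_ι, map_neg, hm', CliffordAlgebra.star_ι]
  | mul a b ha hb => rw [star_mul, map_mul, map_mul, star_mul, ha, hb]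
  | add a b ha hb => rw [star_add, map_add, map_add, star_add, ha, hb]

/-- A ring homomorphism of Clifford algebras that sends scalars to scalars and vectors to vectors
sends the spin group to the spin group. -/
theorem map_mem_spinGroup (f : CliffordAlgebra Q →+* CliffordAlgebra Q')
    (hs : ∀ r : R, ∃ r' : R', f (algebraMap R _ r) = algebraMap R' _ r')
    (hv : ∀ m : M, ∃ m' : M', f (CliffordAlgebra.ι Q m) = CliffordAlgebra.ι Q' m')
    {x : CliffordAlgebra Q} (hx : x ∈ spinGroup Q) : f x ∈ spinGroup Q' := by
  refine ⟨⟨?_, ?_⟩, ?_⟩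
  · obtain ⟨u, hu, rfl⟩ := hx.1.1
    refine ⟨Units.map f.toMonoidHom u, ?_, rfl⟩
    have hle : lipschitzGroup Q ≤ (lipschitzGroup Q').comap (Units.map f.toMonoidHom) := by
      refine (Subgroup.closure_le _).2 ?_
      rintro w ⟨m, hm⟩
      obtain ⟨m', hm'⟩ := hv m
      refine Subgroup.subset_closure ⟨m', ?_⟩
      rw [← hm', hm]
      rfl
    exact hle hu
  · refine Unitary.mem_iff.2 ⟨?_, ?_⟩
    · rw [← map_star_of_mapsTo f hs hv, ← map_mul, hx.1.2.1, map_one]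
    · rw [← map_star_of_mapsTo f hs hv, ← map_mul, hx.1.2.2, map_one]
  · have key : ∀ y (_ : y ∈ CliffordAlgebra.evenOdd Q 0), f y ∈ CliffordAlgebra.even Q' := by
      intro y hy
      induction y, hy using CliffordAlgebra.even_induction with
      | algebraMap r =>
        obtain ⟨r', hr'⟩ := hs r
        rw [hr']
        exact Subalgebra.algebraMap_mem _ _
      | add a b _ _ ha hb =>
        rw [map_add]
        exact Subalgebra.add_mem _ ha hb
      | ι_mul_ι_mul m₁ m₂ a _ ha =>
        obtain ⟨m₁', h₁⟩ := hv m₁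
        obtain ⟨m₂', h₂⟩ := hv m₂
        rw [map_mul, map_mul, h₁, h₂]
        exact Subalgebra.mul_mem _ (CliffordAlgebra.ι_mul_ι_mem_evenOdd_zero Q' m₁' m₂') ha
    exact key x hx.2

/-- The homomorphism of spin groups induced by a ring homomorphism of Clifford algebras that sends
scalars to scalars and vectors to vectors. -/
def spinMap (f : CliffordAlgebra Q →+* CliffordAlgebra Q')
    (hs : ∀ r : R, ∃ r' : R', f (algebraMap R _ r) = algebraMap R' _ r')
    (hv : ∀ m : M, ∃ m' : M', f (CliffordAlgebra.ι Q m) = CliffordAlgebra.ι Q' m') :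
    spinGroup Q →* spinGroup Q' where
  toFun x := ⟨f x, map_mem_spinGroup f hs hv x.2⟩
  map_one' := Subtype.ext (map_one f)
  map_mul' _ _ := Subtype.ext (map_mul f _ _)

end Functoriality

/-! ### The spin group over the algebraic closure and its Frobenius endomorphism -/

section Frobenius

variable {F : Type*} [Field F] [Fintype F] [Invertible (2 : F)]
  {V : Type*} [AddCommGroup V] [Module F V]

/-- The quadratic form `Q` extended to `F̄ ⊗ V`, where `F̄` is the algebraic closure of `F`. -/
abbrev geomForm (Q : QuadraticForm F V) :
    QuadraticForm (AlgebraicClosure F) (AlgebraicClosure F ⊗[F] V) :=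
  Q.baseChange (AlgebraicClosure F)

/-- The inclusion of `Spin(V, Q)` in `Spin(F̄ ⊗ V, Q)`, induced by `v ↦ 1 ⊗ v`. -/
def spinIncl (Q : QuadraticForm F V) : spinGroup Q →* spinGroup (geomForm Q) :=
  spinMap (CliffordAlgebra.ofBaseChangeAux (AlgebraicClosure F) Q).toRingHom
    (fun r => ⟨algebraMap F (AlgebraicClosure F) r, by
      change CliffordAlgebra.ofBaseChangeAux (AlgebraicClosure F) Q (algebraMap F _ r) = _
      rw [AlgHom.commutes, ← IsScalarTower.algebraMap_apply]⟩)
    (fun v => ⟨1 ⊗ₜ[F] v, CliffordAlgebra.ofBaseChangeAux_ι (AlgebraicClosure F) Q v⟩)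

/-- The map of `F̄ ⊗ Cl(V, Q)` which is `a ⊗ c ↦ a ^ q ⊗ c` where `q = |F|`, viewed as a ring
endomorphism of `Cl(F̄ ⊗ V, Q)`. -/
def cliffordFrob (Q : QuadraticForm F V) :
    CliffordAlgebra (geomForm Q) →+* CliffordAlgebra (geomForm Q) :=
  ((CliffordAlgebra.ofBaseChange (AlgebraicClosure F) Q).toRingHom.comp
    (Algebra.TensorProduct.map (FiniteField.frobeniusAlgHom F (AlgebraicClosure F))
      (AlgHom.id F (CliffordAlgebra Q))).toRingHom).comp
    (CliffordAlgebra.toBaseChange (AlgebraicClosure F) Q).toRingHom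

theorem cliffordFrob_algebraMap (Q : QuadraticForm F V) (a : AlgebraicClosure F) :
    cliffordFrob Q (algebraMap _ _ a) = algebraMap _ _ (a ^ Fintype.card F) := by
  change CliffordAlgebra.ofBaseChange (AlgebraicClosure F) Q
    (Algebra.TensorProduct.map (FiniteField.frobeniusAlgHom F (AlgebraicClosure F))
      (AlgHom.id F (CliffordAlgebra Q))
      (CliffordAlgebra.toBaseChange (AlgebraicClosure F) Q (algebraMap _ _ a))) = _
  rw [AlgHom.commutes, Algebra.TensorProduct.algebraMap_apply, Algebra.TensorProduct.map_tmul,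
    map_one, CliffordAlgebra.ofBaseChange_tmul_one]
  rfl

theorem cliffordFrob_ι_tmul (Q : QuadraticForm F V) (a : AlgebraicClosure F) (v : V) :
    cliffordFrob Q (CliffordAlgebra.ι (geomForm Q) (a ⊗ₜ[F] v)) =
      CliffordAlgebra.ι (geomForm Q) ((a ^ Fintype.card F) ⊗ₜ[F] v) := by
  change CliffordAlgebra.ofBaseChange (AlgebraicClosure F) Q
    (Algebra.TensorProduct.map (FiniteField.frobeniusAlgHom F (AlgebraicClosure F))
      (AlgHom.id F (CliffordAlgebra Q))
      (CliffordAlgebra.toBaseChange (AlgebraicClosure F) Q _)) = _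
  rw [CliffordAlgebra.toBaseChange_ι, Algebra.TensorProduct.map_tmul, AlgHom.id_apply,
    CliffordAlgebra.ofBaseChange_tmul_ι]
  rfl

theorem cliffordFrob_ι (Q : QuadraticForm F V) (w : AlgebraicClosure F ⊗[F] V) :
    ∃ w', cliffordFrob Q (CliffordAlgebra.ι (geomForm Q) w) =
      CliffordAlgebra.ι (geomForm Q) w' := by
  induction w using TensorProduct.induction_on with
  | zero => exact ⟨0, by simp⟩
  | tmul a v => exact ⟨_, cliffordFrob_ι_tmul Q a v⟩
  | add x y hx hy =>
    obtain ⟨x', hx'⟩ := hx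
    obtain ⟨y', hy'⟩ := hy
    exact ⟨x' + y', by rw [map_add, map_add, hx', hy', map_add]⟩

/-- The Frobenius endomorphism `ψ^q` of `Spin(F̄ ⊗ V, Q)`, where `q = |F|`. -/
def spinFrob (Q : QuadraticForm F V) : spinGroup (geomForm Q) →* spinGroup (geomForm Q) :=
  spinMap (cliffordFrob Q) (fun a => ⟨_, cliffordFrob_algebraMap Q a⟩) (cliffordFrob_ι Q)

end Frobenius

/-! ### Elementary abelian subgroups and their types -/

section Types

variable {F : Type*} [Field F] [Invertible (2 : F)] {V : Type*} [AddCommGroup V] [Module F V]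
  {Q : QuadraticForm F V}

/-- The quadratic form has square discriminant: the determinant of its Gram matrix with respect to
some basis is a square. -/
def HasSquareDiscr {M : Type*} [AddCommGroup M] [Module F M] (B : QuadraticForm F M) : Prop :=
  ∃ (n : ℕ) (b : Module.Basis (Fin n) F M), IsSquare (QuadraticForm.discr b B)

/-- The eigenspace in `V` of a subgroup `E` of `Spin(V, Q)` for the character `χ`; an element `e` of
the spin group acts on `V` by `v ↦ e v e⁻¹`, computed in the Clifford algebra. -/
def eigenspace (E : Subgroup (spinGroup Q)) (χ : E →* Fˣ) : Submodule F V where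
  carrier := {v | ∀ e : E, ((e : spinGroup Q) : CliffordAlgebra Q) * CliffordAlgebra.ι Q v *
    (((e : spinGroup Q)⁻¹ : spinGroup Q) : CliffordAlgebra Q) =
      (χ e : F) • CliffordAlgebra.ι Q v}
  zero_mem' := fun e => by simp
  add_mem' := fun {v w} hv hw e => by
    rw [map_add, mul_add, add_mul, hv e, hw e, smul_add]
  smul_mem' := fun a v hv e => by
    rw [map_smul, mul_smul_comm, smul_mul_assoc, hv e, smul_comm]

/-- Type I: all eigenspaces on `V` have square discriminant. -/
def IsTypeI (E : Subgroup (spinGroup Q)) : Prop :=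
  ∀ χ : E →* Fˣ, HasSquareDiscr (Q.restrict (eigenspace E χ))

/-- Type II: not all eigenspaces on `V` have square discriminant. -/
def IsTypeII (E : Subgroup (spinGroup Q)) : Prop :=
  ¬ IsTypeI E

/-- `E` is an elementary abelian `2`-group of rank `n`. -/
def IsElemAbTwoOfRank {G : Type*} [Group G] (E : Subgroup G) (n : ℕ) : Prop :=
  (∀ e ∈ E, e ^ 2 = 1) ∧ Nat.card E = 2 ^ n

/-- `E` contains `z = -1`, the nontrivial element of the kernel of `Spin(V, Q) → SO(V, Q)`. -/
def ContainsZ (E : Subgroup (spinGroup Q)) : Prop :=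
  ∃ e ∈ E, (e : CliffordAlgebra Q) = -1

/-- `ℰₙ`: the elementary abelian `2`-subgroups of rank `n` of `S` that contain `z`. -/
def elemAb (S : Sylow 2 (spinGroup Q)) (n : ℕ) : Set (Subgroup (spinGroup Q)) :=
  {E | E ≤ (S : Subgroup (spinGroup Q)) ∧ IsElemAbTwoOfRank E n ∧ ContainsZ E}

/-- `ℰₙᴵ`. -/
def elemAbI (S : Sylow 2 (spinGroup Q)) (n : ℕ) : Set (Subgroup (spinGroup Q)) :=
  {E | E ∈ elemAb S n ∧ IsTypeI E}

/-- `ℰₙᴵᴵ`. -/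
def elemAbII (S : Sylow 2 (spinGroup Q)) (n : ℕ) : Set (Subgroup (spinGroup Q)) :=
  {E | E ∈ elemAb S n ∧ IsTypeII E}

/-- The conjugate `gEg⁻¹`. -/
def conjSubgroup {G : Type*} [Group G] (g : G) (E : Subgroup G) : Subgroup G :=
  E.map (MulAut.conj g).toMonoidHom

/-- `ℰ₄ᴵᵃ`: the conjugacy class in `ℰ₄ᴵ` of the representative `U₀`. -/
def elemAbIa (S : Sylow 2 (spinGroup Q)) (U₀ : Subgroup (spinGroup Q)) :
    Set (Subgroup (spinGroup Q)) :=
  {U | U ∈ elemAbI S 4 ∧ ∃ h : spinGroup Q, U = conjSubgroup h U₀}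

/-- `ℰ₄ᴵᵇ`: the members of `ℰ₄ᴵ` that are not conjugate to `U₀`. -/
def elemAbIb (S : Sylow 2 (spinGroup Q)) (U₀ : Subgroup (spinGroup Q)) :
    Set (Subgroup (spinGroup Q)) :=
  {U | U ∈ elemAbI S 4 ∧ U ∉ elemAbIa S U₀}

end Types

section Invariant

variable {F : Type*} [Field F] [Fintype F] [Invertible (2 : F)]
  {V : Type*} [AddCommGroup V] [Module F V] {Q : QuadraticForm F V}

/-- `g ∈ Spin(F̄ ⊗ V, Q)` conjugates `U` to a member of `ℰ₄ᴵᵃ`. -/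
def ConjugatesIntoIa (S : Sylow 2 (spinGroup Q)) (U₀ U : Subgroup (spinGroup Q))
    (g : spinGroup (geomForm Q)) : Prop :=
  ∃ U' ∈ elemAbIa S U₀, conjSubgroup g (U.map (spinIncl Q)) = U'.map (spinIncl Q)

/-- `x = 𝐱(U)`: there is an element `g` of `Spin(F̄ ⊗ V, Q)` that conjugates `U` to a member of
`ℰ₄ᴵᵃ`, and `g⁻¹ ψ^q(g) = x` for every such `g`. -/
def IsInvariant (S : Sylow 2 (spinGroup Q)) (U₀ U : Subgroup (spinGroup Q))
    (x : spinGroup Q) : Prop :=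
  (∃ g, ConjugatesIntoIa S U₀ U g) ∧
    ∀ g, ConjugatesIntoIa S U₀ U g → g⁻¹ * spinFrob Q g = spinIncl Q x

end Invariant

end SpinSeven

end

/-!
Let `U` be elementary abelian of rank four with `z = -1 ∈ U`. Then `V` is the orthogonal sum of
lines on which `U` acts by characters of `U/⟨z⟩ ≅ 𝔽₂³`. An element of the spin group of order at
most two negates a subspace of dimension divisible by four (`four_dvd_card_of_mul_self`), and here
one of dimension exactly four unless the element is `1` or `z`. Hence the characters that occur
form the simplex code: each of the seven nontrivial ones occurs once (`exists_equiv_point`). This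
gives a *frame* of `U` (`IsFrame`, `exists_isFrame`), an orthogonal basis `e t` indexed by the
nonzero `t ∈ 𝔽₂³`, in which `U` consists of all elements acting on `e t` by `(-1) ^ (s ⬝ᵥ t)` for
a label `s`; the elements with the same label differ by `z`.

The elements of `U` are, up to scalars, products of vectors of the frame, and they have norm one.
So the classes of the values `Q (e t)` modulo squares form a word orthogonal to the simplex code.
As the discriminant of `Q` is a square, this word lies in the simplex code itself
(`IsFrame.exists_quadraticChar_eq`): there is a label `ξ` such that `Q (e t)` is a square if and
only if `ξ ⬝ᵥ t = 0`. The element `x` is one of the two elements of `U` with label `ξ`. A subgroup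
`E ≤ U` of rank three with `z ∈ E` is the kernel of a character `p` of `U`. Its eigenspaces are
the line `p` and three planes spanned by two lines with sum `p`, so all of them have discriminant
`ξ ⬝ᵥ p` up to squares, and `ξ ⬝ᵥ p = 0` says that `x ∈ E` (`IsFrame.type_of_rank_three`).

Over the algebraic closure the frames of `U` and `U₀` can be made orthonormal, the latter already
over the ground field since `U₀` has type I. A product of reflections, adjusted to lie in the spin
group, carries one frame to the other up to a sign (`exists_spin_transport`). This is the element
`g`. The Frobenius endomorphism `ψ` multiplies a square root of `Q (e t)` by the quadratic
character of `Q (e t)`, so `g⁻¹ ψ(g)` acts on the frame of `U` through the label `ξ`, and it is an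
element of `U` (`IsFrame.exists_conj`).

Any other choice of `g` is `h n g` with `h` rational and `n` in the normaliser of `U₀` over the
algebraic closure, so it suffices to show `ψ(n) = n`. Such an `n` permutes the orthonormal frame
of `U₀` up to signs, through an element of `GL₃(𝔽₂)` (`IsFrame.exists_actsByMatrix`). If this is
the identity, `n` is up to sign a product of vectors of the frame, hence rational. So `ψ(n) = ± n`
defines a homomorphism from `GL₃(𝔽₂)` to `{1, -1}`, which is trivial because `GL₃(𝔽₂)` is
generated by transvections, and these are squares (`IsFrame.spinFrob_eq`).
-/

namespace SpinSeven

open CliffordAlgebra Module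
open scoped TensorProduct

/-! ### Products of orthogonal vectors in a Clifford algebra -/

section Products

variable {K W J : Type*} [Field K] [AddCommGroup W] [Module K W] {Q : QuadraticForm K W}

/-- The product in the Clifford algebra of the vectors `e j`, for `j` in the list `l`. -/
def vecProd (Q : QuadraticForm K W) (e : J → W) (l : List J) : CliffordAlgebra Q :=
  (l.map fun j => ι Q (e j)).prod

@[simp]
theorem vecProd_nil (e : J → W) : vecProd Q e [] = 1 := rfl

@[simp]
theorem vecProd_cons (e : J → W) (j : J) (l : List J) :
    vecProd Q e (j :: l) = ι Q (e j) * vecProd Q e l := by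
  simp [vecProd]

@[simp]
theorem vecProd_append (e : J → W) (l₁ l₂ : List J) :
    vecProd Q e (l₁ ++ l₂) = vecProd Q e l₁ * vecProd Q e l₂ := by
  simp [vecProd]

theorem involute_vecProd (e : J → W) (l : List J) :
    involute (vecProd Q e l) = (-1 : K) ^ l.length • vecProd Q e l := by
  induction l with
  | nil => simp
  | cons j l ih =>
    rw [vecProd_cons, map_mul, ih, involute_ι, List.length_cons, pow_succ, neg_mul, mul_smul_comm]
    simp

theorem reverse_vecProd (e : J → W) (l : List J) :
    reverse (vecProd Q e l) = vecProd Q e l.reverse := by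
  induction l with
  | nil => simp
  | cons j l ih => simp [reverse.map_mul, ih]

theorem star_vecProd (e : J → W) (l : List J) :
    star (vecProd Q e l) = (-1 : K) ^ l.length • vecProd Q e l.reverse := by
  rw [star_def, involute_vecProd, map_smul, reverse_vecProd]

theorem vecProd_mul_reverse (e : J → W) (l : List J) :
    vecProd Q e l * vecProd Q e l.reverse =
      algebraMap K _ ((l.map fun j => Q (e j)).prod) := by
  induction l with
  | nil => simp
  | cons j l ih =>
    rw [List.reverse_cons, vecProd_append, vecProd_cons, mul_assoc, ← mul_assoc (vecProd Q e l), ih,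
      vecProd_cons, vecProd_nil, mul_one, Algebra.commutes, ← mul_assoc, ι_sq_scalar, ← map_mul,
      List.map_cons, List.prod_cons]

theorem vecProd_reverse_mul (e : J → W) (l : List J) :
    vecProd Q e l.reverse * vecProd Q e l =
      algebraMap K _ ((l.map fun j => Q (e j)).prod) := by
  have h := vecProd_mul_reverse (Q := Q) e l.reverse
  rwa [List.reverse_reverse, List.map_reverse, List.prod_reverse] at h

theorem vecProd_mem_evenOdd (e : J → W) (l : List J) :
    vecProd Q e l ∈ evenOdd Q (l.length : ZMod 2) := by
  induction l with
  | nil => simpa using one_le_evenOdd_zero Q (Submodule.mem_one.2 ⟨1, by simp⟩)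
  | cons j l ih =>
    rw [vecProd_cons, List.length_cons, Nat.cast_succ, add_comm]
    exact evenOdd_mul_le Q _ _ (Submodule.mul_mem_mul (ι_mem_evenOdd_one Q _) ih)

theorem span_vecProd_eq_top {e : J → W} (he : Submodule.span K (Set.range e) = ⊤) :
    Submodule.span K (Set.range (vecProd Q e)) = ⊤ := by
  rw [eq_top_iff]
  have hmul : ∀ a ∈ Submodule.span K (Set.range (vecProd Q e)),
      ∀ b ∈ Submodule.span K (Set.range (vecProd Q e)),
        a * b ∈ Submodule.span K (Set.range (vecProd Q e)) := by
    intro a ha b hb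
    have h := Submodule.mul_mem_mul ha hb
    rw [Submodule.span_mul_span] at h
    refine Submodule.span_mono ?_ h
    rintro _ ⟨_, ⟨l, rfl⟩, _, ⟨l', rfl⟩, rfl⟩
    exact ⟨l ++ l', by simp⟩
  intro x _
  induction x using CliffordAlgebra.induction with
  | algebraMap r =>
    rw [Algebra.algebraMap_eq_smul_one]
    exact Submodule.smul_mem _ _ (Submodule.subset_span ⟨[], rfl⟩)
  | ι v =>
    have hv : v ∈ Submodule.span K (Set.range e) := he ▸ Submodule.mem_top
    have h := Submodule.mem_map_of_mem (f := ι Q) hv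
    rw [Submodule.map_span] at h
    refine Submodule.span_mono ?_ h
    rintro _ ⟨_, ⟨j, rfl⟩, rfl⟩
    exact ⟨[j], by simp⟩
  | mul a b ha hb => exact hmul _ (ha trivial) _ (hb trivial)
  | add a b ha hb => exact Submodule.add_mem _ (ha trivial) (hb trivial)

variable [DecidableEq J]

theorem ι_mul_vecProd {e : J → W} (ho : Pairwise fun i j => Q.IsOrtho (e i) (e j)) (j : J)
    (l : List J) :
    ι Q (e j) * vecProd Q e l =
      (-1 : K) ^ (l.length + l.count j) • (vecProd Q e l * ι Q (e j)) := by
  induction l with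
  | nil => simp
  | cons i l ih =>
    rw [vecProd_cons]
    by_cases hij : i = j
    · subst hij
      conv_lhs => rw [ih]
      rw [List.count_cons_self, List.length_cons, mul_smul_comm, mul_assoc]
      congr 1
      ring
    · rw [← mul_assoc, ι_mul_ι_comm_of_isOrtho (ho (Ne.symm hij)), neg_mul, mul_assoc, ih,
        List.count_cons_of_ne hij, List.length_cons, mul_smul_comm, ← neg_smul, mul_assoc]
      congr 1
      ring

theorem vecProd_reverse {e : J → W} (ho : Pairwise fun i j => Q.IsOrtho (e i) (e j)) {l : List J}
    (hl : l.Nodup) :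
    vecProd Q e l.reverse = (-1 : K) ^ l.length.choose 2 • vecProd Q e l := by
  induction l with
  | nil => simp
  | cons j l ih =>
    have hj := ι_mul_vecProd (Q := Q) ho j l
    rw [List.nodup_cons] at hl
    rw [List.count_eq_zero_of_not_mem hl.1, add_zero] at hj
    rw [List.reverse_cons, vecProd_append, ih hl.2, vecProd_cons, vecProd_nil, mul_one,
      vecProd_cons, hj, smul_smul, smul_mul_assoc, List.length_cons, Nat.choose_succ_succ' _ 1,
      Nat.choose_one_right, pow_add, mul_right_comm, ← mul_pow]
    simp

/-- Two equal factors cancel up to a scalar, so a product in which every vector occurs an even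
number of times is a scalar. -/
theorem vecProd_eq_algebraMap {e : J → W} (ho : Pairwise fun i j => Q.IsOrtho (e i) (e j)) :
    ∀ (n : ℕ) (l : List J), l.length = n → (∀ j, Even (l.count j)) →
      ∃ c : K, vecProd Q e l = algebraMap K _ c := by
  intro n
  induction n using Nat.strong_induction_on with
  | _ n ih =>
    rintro (_ | ⟨j, l⟩) hn hl
    · exact ⟨1, by simp⟩
    · have hj : j ∈ l := by
        have h := hl j
        rw [List.count_cons_self] at h
        exact List.count_pos_iff.1 (by obtain ⟨m, hm⟩ := h; omega)
      obtain ⟨l₁, l₂, rfl⟩ := List.append_of_mem hj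
      obtain ⟨c, hc⟩ := ih (l₁ ++ l₂).length (by subst hn; simp) _ rfl (by
        intro i
        have h := hl i
        simp only [List.count_cons, List.count_append] at h ⊢
        split_ifs at h <;> grind)
      refine ⟨(-1) ^ (l₁.length + l₁.count j) * (Q (e j) * c), ?_⟩
      rw [vecProd_append] at hc
      rw [vecProd_cons, vecProd_append, vecProd_cons, ← mul_assoc, ι_mul_vecProd ho, smul_mul_assoc,
        mul_assoc, ← mul_assoc (ι Q (e j)), ι_sq_scalar, Algebra.left_comm, hc, ← map_mul,
        Algebra.smul_def, ← map_mul]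

end Products

/-! ### Elements that commute with a basis up to sign -/

section Averaging

variable {K W J : Type*} [Field K] [Invertible (2 : K)] [AddCommGroup W] [Module K W]
  {Q : QuadraticForm K W}

theorem two_ne_zero_of_invertible (K : Type*) [Field K] [Invertible (2 : K)] : (2 : K) ≠ 0 :=
  Invertible.ne_zero 2

theorem neg_one_ne_one_of_invertible (K : Type*) [Field K] [Invertible (2 : K)] :
    (-1 : K) ≠ 1 := by
  intro h
  have h2 := two_ne_zero_of_invertible K
  apply h2
  linear_combination -h

theorem clifford_algebraMap_injective (Q : QuadraticForm K W) :
    Function.Injective (algebraMap K (CliffordAlgebra Q)) :=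
  FaithfulSMul.algebraMap_injective _ _

theorem ι_injective (Q : QuadraticForm K W) : Function.Injective (ι Q) := by
  intro v w h
  have h' := congrArg (equivExterior Q) h
  simp only [equivExterior, changeFormEquiv_apply, changeForm_ι] at h'
  exact ExteriorAlgebra.ι_leftInverse.injective h'

variable [DecidableEq J] [Finite J]

/-- An even element which commutes with the vectors of an orthogonal basis up to the signs `δ` is a
combination of those products of basis vectors that do so as well: it is fixed by the averaging
operators `y ↦ (y + δⱼ eⱼ y eⱼ⁻¹) / 2`, which fix these products and kill the others. -/
theorem mem_span_vecProd {e : J → W} (he : Submodule.span K (Set.range e) = ⊤)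
    (ho : Pairwise fun i j => Q.IsOrtho (e i) (e j)) (hq : ∀ j, Q (e j) ≠ 0) {δ : J → K}
    (hδ : ∀ j, δ j = 1 ∨ δ j = -1) {x : CliffordAlgebra Q} (hx : involute x = x)
    (h : ∀ j, x * ι Q (e j) = δ j • (ι Q (e j) * x)) :
    x ∈ Submodule.span K
      (vecProd Q e '' {l | Even l.length ∧ ∀ j, (-1 : K) ^ l.count j = δ j}) := by
  have h2 := two_ne_zero_of_invertible K
  have := Fintype.ofFinite J
  suffices H : ∀ s : Finset J, x ∈ Submodule.span K
      (vecProd Q e '' {l | Even l.length ∧ ∀ j ∈ s, (-1 : K) ^ l.count j = δ j}) by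
    simpa using H Finset.univ
  intro s
  induction s using Finset.induction_on with
  | empty =>
    let T : CliffordAlgebra Q →ₗ[K] CliffordAlgebra Q :=
      (2 : K)⁻¹ • (LinearMap.id + involute.toLinearMap)
    have hT' : ∀ y, T y = (2 : K)⁻¹ • (y + involute y) := fun _ => rfl
    have hT : x = T x := by
      rw [hT', hx, ← two_smul K x, smul_smul, inv_mul_cancel₀ h2, one_smul]
    have hx' : x ∈ Submodule.span K (Set.range (vecProd Q e)) :=
      span_vecProd_eq_top (Q := Q) he ▸ Submodule.mem_top
    rw [hT]
    refine (Submodule.map_span_le T _ _).2 ?_ (Submodule.mem_map_of_mem hx')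
    rintro _ ⟨l, rfl⟩
    rw [hT']
    rcases Nat.even_or_odd l.length with hl | hl
    · exact Submodule.smul_mem _ _ (Submodule.add_mem _ (Submodule.subset_span ⟨l, by simpa, rfl⟩)
        (by
          rw [involute_vecProd, hl.neg_one_pow, one_smul]
          exact Submodule.subset_span ⟨l, by simpa, rfl⟩))
    · simp [involute_vecProd, hl.neg_one_pow]
  | insert j s _ ih =>
    have hsq : δ j * δ j = 1 := by rcases hδ j with h | h <;> simp [h]
    let T : CliffordAlgebra Q →ₗ[K] CliffordAlgebra Q := (2 : K)⁻¹ • (LinearMap.id +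
      (δ j * (Q (e j))⁻¹) • (LinearMap.mulLeft K (ι Q (e j)) ∘ₗ LinearMap.mulRight K (ι Q (e j))))
    have hTd : ∀ y (d : K), y * ι Q (e j) = d • (ι Q (e j) * y) →
        T y = ((2 : K)⁻¹ * (1 + δ j * d)) • y := by
      intro y d hy
      have : ι Q (e j) * (y * ι Q (e j)) = (d * Q (e j)) • y := by
        rw [hy, mul_smul_comm, ← mul_assoc, ι_sq_scalar, ← Algebra.smul_def, smul_smul]
      simp only [T, LinearMap.smul_apply, LinearMap.add_apply, LinearMap.id_apply,
        LinearMap.comp_apply, LinearMap.mulLeft_apply, LinearMap.mulRight_apply, this]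
      have h1 : δ j * (Q (e j))⁻¹ * (d * Q (e j)) = δ j * d := by
        have := hq j
        field_simp
      rw [smul_smul, h1, mul_smul (2 : K)⁻¹, add_smul, one_smul]
    have hTx : x = T x := by
      rw [hTd x _ (h j), hsq]
      norm_num [h2]
    rw [hTx]
    refine (Submodule.map_span_le T _ _).2 ?_ (Submodule.mem_map_of_mem ih)
    rintro _ ⟨l, ⟨hl, hs⟩, rfl⟩
    have hc : vecProd Q e l * ι Q (e j) = (-1 : K) ^ l.count j • (ι Q (e j) * vecProd Q e l) := by
      rw [ι_mul_vecProd ho, smul_smul, pow_add, hl.neg_one_pow, one_mul, ← mul_pow]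
      simp
    rw [hTd _ _ hc]
    by_cases hj : (-1 : K) ^ l.count j = δ j
    · refine Submodule.smul_mem _ _ (Submodule.subset_span ⟨l, ⟨hl, ?_⟩, rfl⟩)
      intro i hi
      rcases Finset.mem_insert.1 hi with rfl | hi
      · exact hj
      · exact hs i hi
    · have : 1 + δ j * (-1 : K) ^ l.count j = 0 := by
        rcases neg_one_pow_eq_or K (l.count j) with h' | h' <;> rcases hδ j with h'' | h'' <;>
          rw [h', h''] at hj ⊢ <;> simp at hj ⊢
      simp [this]

/-- The even elements which commute with an orthogonal basis up to prescribed signs are the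
multiples of one product of basis vectors. -/
theorem exists_eq_smul_vecProd {e : J → W} (he : Submodule.span K (Set.range e) = ⊤)
    (ho : Pairwise fun i j => Q.IsOrtho (e i) (e j)) (hq : ∀ j, Q (e j) ≠ 0) {δ : J → K}
    (hδ : ∀ j, δ j = 1 ∨ δ j = -1) {x : CliffordAlgebra Q} (hx : involute x = x)
    (h : ∀ j, x * ι Q (e j) = δ j • (ι Q (e j) * x)) {l : List J}
    (hl : ∀ j, (-1 : K) ^ l.count j = δ j) : ∃ c : K, x = c • vecProd Q e l := by
  have hs : x * vecProd Q e l.reverse ∈ (1 : Submodule K (CliffordAlgebra Q)) := by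
    refine (Submodule.map_span_le (LinearMap.mulRight K (vecProd Q e l.reverse)) _ _).2 ?_
      (Submodule.mem_map_of_mem (mem_span_vecProd he ho hq hδ hx h))
    rintro _ ⟨l', ⟨_, hl'⟩, rfl⟩
    obtain ⟨c, hc⟩ := vecProd_eq_algebraMap (Q := Q) ho _ (l' ++ l.reverse) rfl (by
      intro j
      rw [List.count_append, List.count_reverse, ← neg_one_pow_eq_one_iff_even
        (neg_one_ne_one_of_invertible K), pow_add, hl, hl']
      rcases hδ j with h | h <;> simp [h])
    rw [LinearMap.mulRight_apply, ← vecProd_append, hc]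
    exact Submodule.mem_one.2 ⟨c, rfl⟩
  obtain ⟨c, hc⟩ := Submodule.mem_one.1 hs
  have hP : (l.map fun j => Q (e j)).prod ≠ 0 := by
    rw [Ne, List.prod_eq_zero_iff]
    simp only [List.mem_map, not_exists, not_and]
    exact fun j _ => hq j
  refine ⟨(l.map fun j => Q (e j)).prod⁻¹ * c, ?_⟩
  rw [mul_smul, Algebra.smul_def c, hc, mul_assoc, vecProd_reverse_mul, ← Algebra.commutes,
    ← Algebra.smul_def, smul_smul, inv_mul_cancel₀ hP, one_smul]

end Averaging

/-! ### Elements of the spin group -/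

section Spin

variable {K W J : Type*} [Field K] [AddCommGroup W] [Module K W]
  {Q : QuadraticForm K W}

theorem coe_mul_coe_inv (g : spinGroup Q) :
    (g : CliffordAlgebra Q) * ((g⁻¹ : spinGroup Q) : CliffordAlgebra Q) = 1 :=
  spinGroup.coe_mul_star_self g

theorem coe_inv_mul_coe (g : spinGroup Q) :
    ((g⁻¹ : spinGroup Q) : CliffordAlgebra Q) * (g : CliffordAlgebra Q) = 1 :=
  spinGroup.coe_star_mul_self g

theorem coe_mul (g h : spinGroup Q) :
    ((g * h : spinGroup Q) : CliffordAlgebra Q) = g * h := rfl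

theorem involute_coe (g : spinGroup Q) : involute (g : CliffordAlgebra Q) = g :=
  spinGroup.involute_eq g.2

theorem coe_mul_left_cancel (g : spinGroup Q) {a b : CliffordAlgebra Q}
    (h : (g : CliffordAlgebra Q) * a = g * b) : a = b := by
  have := congrArg (((g⁻¹ : spinGroup Q) : CliffordAlgebra Q) * ·) h
  simpa [← mul_assoc, coe_inv_mul_coe] using this

theorem coe_mul_right_cancel (g : spinGroup Q) {a b : CliffordAlgebra Q}
    (h : a * (g : CliffordAlgebra Q) = b * g) : a = b := by
  have := congrArg (· * ((g⁻¹ : spinGroup Q) : CliffordAlgebra Q)) h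
  simpa [mul_assoc, coe_mul_coe_inv] using this

theorem conj_inv {g : spinGroup Q} {v w : W} {c : K} (hc : c = 1 ∨ c = -1)
    (h : (g : CliffordAlgebra Q) * ι Q v = c • (ι Q w * g)) :
    ((g⁻¹ : spinGroup Q) : CliffordAlgebra Q) * ι Q w = c • (ι Q v * (g⁻¹ : spinGroup Q)) := by
  have hcc : c * c = 1 := by rcases hc with rfl | rfl <;> norm_num
  apply coe_mul_left_cancel g
  apply coe_mul_right_cancel g
  rw [mul_smul_comm, smul_mul_assoc, ← mul_assoc, coe_mul_coe_inv, one_mul, ← mul_assoc, h,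
    smul_mul_assoc, mul_assoc (ι Q w), coe_mul_coe_inv, mul_one, smul_mul_assoc, smul_smul, hcc,
    one_smul]

theorem conj_mul {g h : spinGroup Q} {u v w : W} {c d : K}
    (hg : (g : CliffordAlgebra Q) * ι Q v = c • (ι Q w * g))
    (hh : (h : CliffordAlgebra Q) * ι Q u = d • (ι Q v * h)) :
    ((g * h : spinGroup Q) : CliffordAlgebra Q) * ι Q u =
      (c * d) • (ι Q w * (g * h : spinGroup Q)) := by
  rw [coe_mul, mul_assoc, hh, mul_smul_comm, ← mul_assoc, hg, smul_mul_assoc, smul_smul,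
    mul_assoc, mul_comm d]

variable [Invertible (2 : K)]

theorem coe_ne_zero (g : spinGroup Q) : (g : CliffordAlgebra Q) ≠ 0 := by
  intro h
  have := coe_mul_coe_inv g
  simp [h] at this

theorem ι_mul_coe_ne_zero (g : spinGroup Q) {v : W} (hv : v ≠ 0) :
    ι Q v * (g : CliffordAlgebra Q) ≠ 0 := by
  intro h
  have h0 : ι Q v = 0 := coe_mul_right_cancel g (by rw [h, zero_mul])
  exact hv (ι_injective Q (by rw [h0, map_zero]))

/-- The action of the spin group on vectors: `g ι(v) g⁻¹` is a vector. -/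
theorem exists_conj_vector (g : spinGroup Q) (v : W) :
    ∃ w, (g : CliffordAlgebra Q) * ι Q v = ι Q w * g := by
  let u : (CliffordAlgebra Q)ˣ := ⟨g, (g⁻¹ : spinGroup Q), coe_mul_coe_inv g, coe_inv_mul_coe g⟩
  obtain ⟨w, hw⟩ := spinGroup.conjAct_smul_ι_mem_range_ι (x := u) g.2 v
  refine ⟨w, ?_⟩
  rw [hw, ConjAct.units_smul_def]
  simp [u, mul_assoc, coe_inv_mul_coe]

theorem quadratic_eq_of_conj {g : spinGroup Q} {v w : W}
    (h : (g : CliffordAlgebra Q) * ι Q v = ι Q w * g) : Q w = Q v := by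
  apply clifford_algebraMap_injective Q
  apply coe_mul_right_cancel g
  rw [← ι_sq_scalar, ← ι_sq_scalar, mul_assoc, ← h, ← mul_assoc, ← h, mul_assoc, ← mul_assoc,
    mul_assoc, ι_sq_scalar, ← Algebra.commutes]

theorem polar_eq_of_conj {g : spinGroup Q} {v w v' w' : W}
    (h : (g : CliffordAlgebra Q) * ι Q v = ι Q w * g)
    (h' : (g : CliffordAlgebra Q) * ι Q v' = ι Q w' * g) :
    QuadraticMap.polar Q w w' = QuadraticMap.polar Q v v' := by
  have hadd : (g : CliffordAlgebra Q) * ι Q (v + v') = ι Q (w + w') * g := by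
    rw [map_add, mul_add, h, h', map_add, add_mul]
  simp only [QuadraticMap.polar, quadratic_eq_of_conj h, quadratic_eq_of_conj h',
    quadratic_eq_of_conj hadd]

theorem eq_one_or_neg_one_of_conj {g : spinGroup Q} {v w : W} {c : K} (hv : Q v ≠ 0)
    (hw : Q w = Q v) (h : (g : CliffordAlgebra Q) * ι Q v = c • (ι Q w * g)) :
    c = 1 ∨ c = -1 := by
  have h' := quadratic_eq_of_conj (w := c • w) (by rw [h, map_smul, smul_mul_assoc])
  rw [QuadraticMap.map_smul, hw, smul_eq_mul] at h'
  exact mul_self_eq_one_iff.1 (mul_right_cancel₀ hv (by rw [h', one_mul]))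

variable [DecidableEq J] [Fintype J] [DecidableEq K]

/-- An element of the spin group that acts diagonally, with signs `δ`, in an orthogonal basis is a
multiple of the product of those basis vectors that it negates. -/
theorem coe_eq_smul_vecProd {e : J → W} (he : Submodule.span K (Set.range e) = ⊤)
    (ho : Pairwise fun i j => Q.IsOrtho (e i) (e j)) (hq : ∀ j, Q (e j) ≠ 0) {δ : J → K}
    (hδ : ∀ j, δ j = 1 ∨ δ j = -1) {g : spinGroup Q}
    (h : ∀ j, (g : CliffordAlgebra Q) * ι Q (e j) = δ j • (ι Q (e j) * g)) :
    ∃ c : K, (g : CliffordAlgebra Q) = c • vecProd Q e ({j | δ j = -1} : Finset J).toList ∧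
      Even ({j | δ j = -1} : Finset J).card ∧
      c * c * ∏ j ∈ ({j | δ j = -1} : Finset J), Q (e j) = 1 := by
  set A := ({j | δ j = -1} : Finset J) with hA
  have h1 := neg_one_ne_one_of_invertible K
  obtain ⟨c, hc⟩ := exists_eq_smul_vecProd (l := A.toList) he ho hq hδ (involute_coe g) h (by
    intro j
    rcases hδ j with hj | hj
    · rw [List.count_eq_zero_of_not_mem (by simp [hA, hj, h1.symm]), pow_zero, hj]
    · rw [List.count_eq_one_of_mem A.nodup_toList (by simp [hA, hj]), pow_one, hj])
  have hev : Even A.card := by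
    have hi := involute_coe g
    rw [hc, map_smul, involute_vecProd, smul_comm, ← hc, Finset.length_toList] at hi
    have : ((-1 : K) ^ A.card - 1) • (g : CliffordAlgebra Q) = 0 := by
      rw [sub_smul, hi, one_smul, sub_self]
    rcases smul_eq_zero.1 this with h' | h'
    · exact (neg_one_pow_eq_one_iff_even h1).1 (sub_eq_zero.1 h')
    · exact absurd h' (coe_ne_zero g)
  refine ⟨c, hc, hev, clifford_algebraMap_injective Q ?_⟩
  have hs : (g : CliffordAlgebra Q) * star (g : CliffordAlgebra Q) = 1 :=
    spinGroup.coe_mul_star_self g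
  rw [hc, CliffordAlgebra.star_smul, star_vecProd, Finset.length_toList, hev.neg_one_pow, one_smul,
    smul_mul_smul_comm, vecProd_mul_reverse, Algebra.smul_def, ← map_mul,
    Finset.prod_map_toList] at hs
  rw [hs, map_one]

/-- The kernel of the action of the spin group on vectors is `{1, -1}`. -/
theorem coe_eq_one_or_neg_one {e : J → W} (he : Submodule.span K (Set.range e) = ⊤)
    (ho : Pairwise fun i j => Q.IsOrtho (e i) (e j)) (hq : ∀ j, Q (e j) ≠ 0) {g : spinGroup Q}
    (h : ∀ j, (g : CliffordAlgebra Q) * ι Q (e j) = ι Q (e j) * g) :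
    (g : CliffordAlgebra Q) = 1 ∨ (g : CliffordAlgebra Q) = -1 := by
  obtain ⟨c, hc, -, hc'⟩ := coe_eq_smul_vecProd (δ := fun _ => 1) he ho hq (fun _ => Or.inl rfl)
    (g := g) (fun j => by rw [h, one_smul])
  have h1 := neg_one_ne_one_of_invertible K
  simp only [h1.symm, Finset.filter_false, Finset.prod_empty, mul_one,
    Finset.toList_empty, vecProd_nil] at hc hc'
  rcases mul_self_eq_one_iff.1 hc' with rfl | rfl
  · left; simpa using hc
  · right; simpa using hc

/-- An involution of the spin group has an eigenspace for `-1` of dimension divisible by `4`. -/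
theorem four_dvd_card_of_mul_self {e : J → W} (he : Submodule.span K (Set.range e) = ⊤)
    (ho : Pairwise fun i j => Q.IsOrtho (e i) (e j)) (hq : ∀ j, Q (e j) ≠ 0) {δ : J → K}
    (hδ : ∀ j, δ j = 1 ∨ δ j = -1) {g : spinGroup Q} (hg : g * g = 1)
    (h : ∀ j, (g : CliffordAlgebra Q) * ι Q (e j) = δ j • (ι Q (e j) * g)) :
    4 ∣ ({j | δ j = -1} : Finset J).card := by
  obtain ⟨c, hc, hev, -⟩ := coe_eq_smul_vecProd he ho hq hδ h
  set A := ({j | δ j = -1} : Finset J) with hA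
  have hs : star (g : CliffordAlgebra Q) = g :=
    congrArg Subtype.val (inv_eq_of_mul_eq_one_left hg)
  rw [hc, CliffordAlgebra.star_smul, star_vecProd, Finset.length_toList, hev.neg_one_pow, one_smul,
    vecProd_reverse ho A.nodup_toList, smul_comm, ← hc, Finset.length_toList] at hs
  have : ((-1 : K) ^ A.card.choose 2 - 1) • (g : CliffordAlgebra Q) = 0 := by
    rw [sub_smul, hs, one_smul, sub_self]
  rcases smul_eq_zero.1 this with h' | h'
  · obtain ⟨m, hm⟩ := hev
    have h2 := (neg_one_pow_eq_one_iff_even (neg_one_ne_one_of_invertible K)).1 (sub_eq_zero.1 h')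
    have h3 : (m + m).choose 2 = m * (2 * m - 1) := by
      rw [Nat.choose_two_right, ← two_mul, mul_assoc, Nat.mul_div_cancel_left _ two_pos]
    rw [hm, h3, Nat.even_mul] at h2
    rcases Nat.eq_zero_or_pos m with rfl | hm0
    · simp [hm]
    · have : Even m := h2.resolve_right (by rw [Nat.not_even_iff_odd]; exact ⟨m - 1, by omega⟩)
      obtain ⟨k, hk⟩ := this
      exact ⟨k, by omega⟩
  · exact absurd h' (coe_ne_zero g)

end Spin

/-! ### Transporting orthonormal families by the spin group -/

section Transport

variable {K W J : Type*} [Field K] [AddCommGroup W] [Module K W] {Q : QuadraticForm K W}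

/-- The isometry `R` is the twisted conjugation by the product of the unit vectors in `l`. -/
def IsReflectionProd (Q : QuadraticForm K W) (l : List W) (R : W →ₗ[K] W) : Prop :=
  (∀ w ∈ l, Q w = 1) ∧ (∀ v, Q (R v) = Q v) ∧
    ∀ v, vecProd Q id l * ι Q v = (-1 : K) ^ l.length • (ι Q (R v) * vecProd Q id l)

theorem isReflectionProd_nil : IsReflectionProd Q [] LinearMap.id :=
  ⟨by simp, by simp, by simp⟩

theorem IsReflectionProd.append {l l' : List W} {R R' : W →ₗ[K] W}
    (h : IsReflectionProd Q l R) (h' : IsReflectionProd Q l' R') :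
    IsReflectionProd Q (l ++ l') (R ∘ₗ R') := by
  refine ⟨?_, fun v => by rw [LinearMap.comp_apply, h.2.1, h'.2.1], fun v => ?_⟩
  · simp only [List.mem_append]
    rintro w (hw | hw)
    · exact h.1 w hw
    · exact h'.1 w hw
  · rw [vecProd_append, mul_assoc, h'.2.2, mul_smul_comm, ← mul_assoc, h.2.2, smul_mul_assoc,
      smul_smul, List.length_append, pow_add, mul_comm, LinearMap.comp_apply, mul_assoc]

/-- The reflection in the unit vector `w`. -/
def unitReflection (Q : QuadraticForm K W) (w : W) : W →ₗ[K] W :=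
  LinearMap.id - (Q.polarBilin w).smulRight w

theorem unitReflection_apply (w v : W) :
    unitReflection Q w v = v - QuadraticMap.polar Q w v • w := rfl

theorem isReflectionProd_singleton {w : W} (hw : Q w = 1) :
    IsReflectionProd Q [w] (unitReflection Q w) := by
  refine ⟨by simpa, fun v => ?_, fun v => ?_⟩
  · have h := QuadraticMap.map_add Q v (-(QuadraticMap.polar Q w v • w))
    rw [QuadraticMap.polar_neg_right, QuadraticMap.polar_smul_right, QuadraticMap.map_neg,
      QuadraticMap.map_smul, hw, QuadraticMap.polar_comm Q v w] at h
    rw [unitReflection_apply, sub_eq_add_neg, h]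
    simp
  · have h := ι_mul_ι_add_swap (Q := Q) w v
    have hs := ι_sq_scalar Q w
    rw [hw, map_one] at hs
    rw [unitReflection_apply, vecProd_cons, vecProd_nil, mul_one, id, List.length_singleton,
      pow_one, neg_one_smul, map_sub, map_smul, sub_mul, smul_mul_assoc, hs,
      ← Algebra.algebraMap_eq_smul_one, ← h]
    abel

theorem exists_isReflectionProd_pair [IsAlgClosed K] [Invertible (2 : K)] {a b : W} (ha : Q a = 1)
    (hb : Q b = 1) : ∃ l R, IsReflectionProd Q l R ∧ R a = b ∧
      ∀ c, QuadraticMap.polar Q a c = 0 → QuadraticMap.polar Q b c = 0 → R c = c := by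
  have h2 := two_ne_zero_of_invertible K
  have hsub : Q (a - b) = 2 - QuadraticMap.polar Q a b := by
    have h := QuadraticMap.map_add Q a (-b)
    rw [QuadraticMap.polar_neg_right, QuadraticMap.map_neg, ha, hb] at h
    rw [sub_eq_add_neg, h]
    ring
  have hadd : Q (a + b) = 2 + QuadraticMap.polar Q a b := by
    rw [QuadraticMap.map_add Q, ha, hb]
    ring
  have haa : QuadraticMap.polar Q a a = 2 := by rw [QuadraticMap.polar_self, ha]; norm_num
  have hbb : QuadraticMap.polar Q b b = 2 := by rw [QuadraticMap.polar_self, hb]; norm_num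
  have hba := QuadraticMap.polar_comm Q b a
  by_cases hd : Q (a - b) = 0
  · have hd' : Q (a + b) ≠ 0 := by
      intro h
      apply mul_ne_zero h2 h2
      linear_combination hsub + hadd + h + hd - hsub * 2 - hadd * 2
    obtain ⟨s, hs⟩ := IsAlgClosed.exists_eq_mul_self (Q (a + b))
    have hs0 : s ≠ 0 := by rintro rfl; simp [hs] at hd'
    have hw : Q (s⁻¹ • (a + b)) = 1 := by
      rw [QuadraticMap.map_smul, hs, smul_eq_mul]
      field_simp
    refine ⟨_, _, (isReflectionProd_singleton hb).append (isReflectionProd_singleton hw), ?_, ?_⟩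
    · have h1 : unitReflection Q (s⁻¹ • (a + b)) a = -b := by
        rw [unitReflection_apply, QuadraticMap.polar_smul_left, QuadraticMap.polar_add_left, haa,
          hba, ← hadd, hs, smul_eq_mul, smul_smul]
        have : s⁻¹ * (s * s) * s⁻¹ = 1 := by field_simp
        rw [this, one_smul]
        abel
      rw [LinearMap.comp_apply, h1, unitReflection_apply, QuadraticMap.polar_neg_right, hbb,
        neg_smul, two_smul]
      abel
    · intro c hac hbc
      have h1 : unitReflection Q (s⁻¹ • (a + b)) c = c := by
        rw [unitReflection_apply, QuadraticMap.polar_smul_left, QuadraticMap.polar_add_left, hac,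
          hbc]
        simp
      rw [LinearMap.comp_apply, h1, unitReflection_apply, hbc, zero_smul, sub_zero]
  · obtain ⟨s, hs⟩ := IsAlgClosed.exists_eq_mul_self (Q (a - b))
    have hs0 : s ≠ 0 := by rintro rfl; simp [hs] at hd
    have hw : Q (s⁻¹ • (a - b)) = 1 := by
      rw [QuadraticMap.map_smul, hs, smul_eq_mul]
      field_simp
    refine ⟨_, _, isReflectionProd_singleton hw, ?_, ?_⟩
    · rw [unitReflection_apply, QuadraticMap.polar_smul_left, QuadraticMap.polar_sub_left, haa,
        hba, ← hsub, hs, smul_eq_mul, smul_smul]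
      have : s⁻¹ * (s * s) * s⁻¹ = 1 := by field_simp
      rw [this, one_smul]
      abel
    · intro c hac hbc
      rw [unitReflection_apply, QuadraticMap.polar_smul_left, QuadraticMap.polar_sub_left, hac,
        hbc]
      simp

theorem exists_isReflectionProd_family [IsAlgClosed K] [Invertible (2 : K)] {u u' : J → W}
    (hu : ∀ j, Q (u j) = 1) (hu' : ∀ j, Q (u' j) = 1)
    (ho : Pairwise fun i j => Q.IsOrtho (u i) (u j))
    (ho' : Pairwise fun i j => Q.IsOrtho (u' i) (u' j)) (s : Finset J) :
    ∃ l R, IsReflectionProd Q l R ∧ ∀ j ∈ s, R (u j) = u' j := by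
  classical
  induction s using Finset.induction_on with
  | empty => exact ⟨[], _, isReflectionProd_nil, by simp⟩
  | insert j s hj ih =>
    obtain ⟨l, R, hR, hs⟩ := ih
    obtain ⟨l', R', hR', hj', hc⟩ := exists_isReflectionProd_pair (Q := Q) (a := R (u j))
      (b := u' j) (by rw [hR.2.1, hu]) (hu' j)
    refine ⟨_, _, hR'.append hR, fun i hi => ?_⟩
    rcases Finset.mem_insert.1 hi with rfl | hi
    · exact hj'
    · have hij : j ≠ i := by rintro rfl; exact hj hi
      rw [LinearMap.comp_apply, hs i hi]
      refine hc _ ?_ (ho' hij).polar_eq_zero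
      rw [← hs i hi, QuadraticMap.polar, ← map_add, hR.2.1, hR.2.1, hR.2.1]
      exact (ho hij).polar_eq_zero

theorem vecProd_mem_spinGroup {l : List W} (hl : ∀ w ∈ l, Q w = 1) (hev : Even l.length) :
    vecProd Q id l ∈ spinGroup Q := by
  have hprod : (l.map fun w => Q (id w)).prod = 1 :=
    List.prod_eq_one (by simpa using hl)
  refine ⟨⟨?_, Unitary.mem_iff.2 ⟨?_, ?_⟩⟩, ?_⟩
  · refine Submonoid.list_prod_mem _ ?_
    simp only [List.mem_map]
    rintro _ ⟨w, hw, rfl⟩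
    have hw1 : IsUnit (ι Q w) := isUnit_ι_of_isUnit Q (by rw [hl w hw]; exact isUnit_one)
    exact ⟨hw1.unit, Subgroup.subset_closure ⟨w, rfl⟩, rfl⟩
  · rw [star_vecProd, hev.neg_one_pow, one_smul, vecProd_reverse_mul, hprod, map_one]
  · rw [star_vecProd, hev.neg_one_pow, one_smul, vecProd_mul_reverse, hprod, map_one]
  · have h := vecProd_mem_evenOdd (Q := Q) id l
    rwa [(ZMod.natCast_eq_zero_iff_even).2 hev] at h

/-- Over an algebraically closed field, two orthonormal families of odd size are conjugate under the
spin group up to a global sign: a product of reflections carries one to the other, and multiplying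
by the product of the whole family, which commutes with it, corrects the parity if needed. -/
theorem exists_spin_transport [IsAlgClosed K] [Invertible (2 : K)] [Fintype J]
    (hJ : Odd (Fintype.card J)) {u u' : J → W} (hu : ∀ j, Q (u j) = 1) (hu' : ∀ j, Q (u' j) = 1)
    (ho : Pairwise fun i j => Q.IsOrtho (u i) (u j))
    (ho' : Pairwise fun i j => Q.IsOrtho (u' i) (u' j)) :
    ∃ (g : spinGroup Q) (c : K), (c = 1 ∨ c = -1) ∧
      ∀ j, (g : CliffordAlgebra Q) * ι Q (u j) = c • (ι Q (u' j) * g) := by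
  classical
  obtain ⟨l, R, ⟨h1, -, h3⟩, hR⟩ :=
    exists_isReflectionProd_family hu hu' ho ho' Finset.univ
  have h4 : ∀ j, vecProd Q id l * ι Q (u j) =
      (-1 : K) ^ l.length • (ι Q (u' j) * vecProd Q id l) := fun j => by
    rw [h3, hR j (Finset.mem_univ j)]
  rcases Nat.even_or_odd l.length with hl | hl
  · exact ⟨⟨_, vecProd_mem_spinGroup h1 hl⟩, _, neg_one_pow_eq_or K _, h4⟩
  · set m : List J := Finset.univ.toList
    have hm : vecProd Q id (m.map u) = vecProd Q u m := by simp [vecProd, Function.comp_def]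
    have hml : m.length = Fintype.card J := by simp [m]
    refine ⟨⟨vecProd Q id (l ++ m.map u), vecProd_mem_spinGroup ?_ ?_⟩, _,
      neg_one_pow_eq_or K l.length, fun j => ?_⟩
    · simp only [List.mem_append, List.mem_map]
      rintro w (hw | ⟨j, -, rfl⟩)
      · exact h1 w hw
      · exact hu j
    · rw [List.length_append, List.length_map, hml]
      exact hl.add_odd hJ
    · have hcom := ι_mul_vecProd (Q := Q) ho j m
      rw [List.count_eq_one_of_mem (Finset.nodup_toList _) (by simp), hml,
        (hJ.add_odd odd_one).neg_one_pow, one_smul] at hcom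
      change vecProd Q id _ * _ = _ • (_ * vecProd Q id _)
      rw [vecProd_append, hm, mul_assoc, ← hcom, ← mul_assoc, h4, smul_mul_assoc, mul_assoc]

end Transport

/-! ### Discriminants in orthogonal bases -/

theorem hasSquareDiscr_iff {F M J : Type*} [Field F] [Invertible (2 : F)] [AddCommGroup M]
    [Module F M] {B : QuadraticForm F M} [Fintype J] (e : Basis J F M)
    (ho : Pairwise fun i j => B.IsOrtho (e i) (e j)) :
    HasSquareDiscr B ↔ IsSquare (∏ j, B (e j)) := by
  classical
  have hdiag : ∀ {n : ℕ} (f : J ≃ Fin n),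
      QuadraticForm.discr (e.reindex f) B = ∏ j, B (e j) := by
    intro n f
    have hm : QuadraticForm.toMatrix (e.reindex f) B =
        Matrix.diagonal fun i => B (e.reindex f i) := by
      ext i j
      rw [QuadraticForm.toMatrix, LinearMap.toMatrix₂_apply, Matrix.diagonal_apply]
      split_ifs with hij
      · subst hij
        exact QuadraticMap.associated_eq_self_apply _ _ _
      · rw [QuadraticMap.associated_isOrtho.2]
        simpa using ho fun h => hij (f.symm.injective h)
    rw [QuadraticForm.discr, hm, Matrix.det_diagonal, ← Equiv.prod_comp f]
    simp
  constructor
  · rintro ⟨n, b, hb⟩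
    have hcard : Fintype.card J = n := by
      rw [← finrank_eq_card_basis e, finrank_eq_card_basis b, Fintype.card_fin]
    let f : J ≃ Fin n := Fintype.equivFinOfCardEq hcard
    have h := QuadraticForm.discr_comp (b := b) (e.reindex f) B LinearMap.id
    rw [hdiag] at h
    change QuadraticForm.discr b B = _ at h
    have hd : (LinearMap.toMatrix b (e.reindex f) LinearMap.id).det ≠ 0 :=
      ((LinearEquiv.refl F M).isUnit_det b (e.reindex f)).ne_zero
    rw [h] at hb
    generalize (LinearMap.toMatrix b (e.reindex f) LinearMap.id).det = d at hd hb
    have hs := hb.mul (IsSquare.mul_self d⁻¹)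
    rwa [show ∀ x : F, d * d * x * (d⁻¹ * d⁻¹) = x by intro x; field_simp] at hs
  · exact fun h => ⟨_, e.reindex (Fintype.equivFin J), by rwa [hdiag]⟩

/-! ### Common eigenbases of elementary abelian subgroups -/

section Eigenbasis

variable {K W : Type*} [Field K] [Invertible (2 : K)] [AddCommGroup W] [Module K W]
  {Q : QuadraticForm K W}

/-- The vector `v` is an eigenvector, with eigenvalue `1` or `-1`, of every element of `s`. -/
def IsSignVector (s : Set (spinGroup Q)) (v : W) : Prop :=
  ∀ g ∈ s, ∃ c : K, (c = 1 ∨ c = -1) ∧ (g : CliffordAlgebra Q) * ι Q v = c • (ι Q v * g)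

/-- The orthogonal complement of common eigenvectors, if it is anisotropic somewhere, contains an
anisotropic common eigenvector: for an involution `g`, one of `v + g v` and `v - g v` is
anisotropic if `v` is. -/
theorem exists_signVector {U : Subgroup (spinGroup Q)} (hU : ∀ u ∈ U, u ^ 2 = 1) {X : Set W}
    (hX : ∀ x ∈ X, IsSignVector (U : Set (spinGroup Q)) x) (s : Finset (spinGroup Q))
    (hs : ∀ u ∈ s, u ∈ U) {v : W} (hv : Q v ≠ 0) (hvX : ∀ x ∈ X, QuadraticMap.polar Q x v = 0) :
    ∃ w, Q w ≠ 0 ∧ (∀ x ∈ X, QuadraticMap.polar Q x w = 0) ∧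
      IsSignVector (s : Set (spinGroup Q)) w := by
  classical
  induction s using Finset.induction_on with
  | empty => exact ⟨v, hv, hvX, by simp [IsSignVector]⟩
  | insert u s _ ih =>
    obtain ⟨w, hw, hwX, hws⟩ := ih fun g hg => hs g (Finset.mem_insert_of_mem hg)
    have huU := hs u (Finset.mem_insert_self _ _)
    obtain ⟨w', hw'⟩ := exists_conj_vector u w
    have hcomm : ∀ g ∈ s, g * u = u * g := fun g hg => by
      have hgU := hs g (Finset.mem_insert_of_mem hg)
      have h1 := hU _ (U.mul_mem hgU huU)
      have h2 := hU _ hgU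
      have h3 := hU _ huU
      rw [pow_two] at h1 h2 h3
      have h4 : (g * u)⁻¹ = g * u := inv_eq_of_mul_eq_one_left h1
      rw [← h4, mul_inv_rev, inv_eq_of_mul_eq_one_left h2, inv_eq_of_mul_eq_one_left h3]
    have hu2 : (u : CliffordAlgebra Q) * u = 1 := by
      rw [← coe_mul, ← pow_two, hU u huU]
      rfl
    have hw'' : (u : CliffordAlgebra Q) * ι Q w' = ι Q w * u := by
      apply coe_mul_right_cancel u
      rw [mul_assoc, ← hw', ← mul_assoc, hu2, one_mul, mul_assoc, hu2, mul_one]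
    have hw'X : ∀ x ∈ X, QuadraticMap.polar Q x w' = 0 := by
      intro x hx
      obtain ⟨c, hc, hcx⟩ := hX x hx u huU
      have hp := polar_eq_of_conj (w := c • x) (by rw [hcx, map_smul, smul_mul_assoc]) hw'
      rw [QuadraticMap.polar_smul_left, hwX x hx, smul_eq_mul] at hp
      rcases hc with rfl | rfl <;> simpa using hp
    have hw's : IsSignVector (s : Set (spinGroup Q)) w' ∧ ∀ g ∈ s, ∃ c : K, (c = 1 ∨ c = -1) ∧
        (g : CliffordAlgebra Q) * ι Q w = c • (ι Q w * g) ∧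
        (g : CliffordAlgebra Q) * ι Q w' = c • (ι Q w' * g) := by
      have h : ∀ g ∈ s, ∃ c : K, (c = 1 ∨ c = -1) ∧
          (g : CliffordAlgebra Q) * ι Q w = c • (ι Q w * g) ∧
          (g : CliffordAlgebra Q) * ι Q w' = c • (ι Q w' * g) := by
        intro g hg
        obtain ⟨c, hc, hcw⟩ := hws g hg
        refine ⟨c, hc, hcw, ?_⟩
        apply coe_mul_right_cancel u
        have hgu := congrArg (Subtype.val) (hcomm g hg)
        rw [coe_mul, coe_mul] at hgu
        rw [mul_assoc, ← hw', ← mul_assoc, hgu, mul_assoc, hcw, mul_smul_comm, ← mul_assoc, hw',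
          mul_assoc, ← hgu, smul_mul_assoc, mul_assoc]
      exact ⟨fun g hg => let ⟨c, hc, _, h2⟩ := h g hg; ⟨c, hc, h2⟩, h⟩
    obtain ⟨-, hboth⟩ := hw's
    have hQ' := quadratic_eq_of_conj hw'
    have hsum : Q (w + w') + Q (w - w') = 4 * Q w := by
      have h1 := QuadraticMap.map_add Q w w'
      have h2 := QuadraticMap.map_add Q w (-w')
      rw [QuadraticMap.polar_neg_right, QuadraticMap.map_neg] at h2
      rw [sub_eq_add_neg, h1, h2, hQ']
      ring
    have h2 := two_ne_zero_of_invertible K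
    -- The two candidates are treated together, as `w + d w'` with `d` a sign.
    obtain ⟨d, hd, hQd⟩ : ∃ d : K, (d = 1 ∨ d = -1) ∧ Q (w + d • w') ≠ 0 := by
      by_contra! hcon
      have h1 := hcon 1 (Or.inl rfl)
      have h3 := hcon (-1) (Or.inr rfl)
      rw [one_smul] at h1
      rw [neg_one_smul, ← sub_eq_add_neg] at h3
      rw [h1, h3] at hsum
      apply mul_ne_zero (mul_ne_zero h2 h2) hw
      linear_combination -hsum
    have hdd : d * d = 1 := by rcases hd with rfl | rfl <;> norm_num
    refine ⟨_, hQd, fun x hx => ?_, fun g hg => ?_⟩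
    · rw [QuadraticMap.polar_add_right, QuadraticMap.polar_smul_right, hwX x hx, hw'X x hx]
      simp
    · rcases Finset.mem_insert.1 (Finset.mem_coe.1 hg) with rfl | hg
      · refine ⟨d, hd, ?_⟩
        rw [map_add, map_smul, mul_add, mul_smul_comm, hw', hw'', add_mul, smul_add,
          smul_mul_assoc, smul_smul, hdd, one_smul, add_comm]
      · obtain ⟨c, hc, h1, h2⟩ := hboth g hg
        refine ⟨c, hc, ?_⟩
        rw [map_add, map_smul, mul_add, mul_smul_comm, h1, h2, add_mul, smul_add,
          smul_mul_assoc, smul_comm]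

/-- A proper orthogonal family of anisotropic vectors of a nondegenerate space has an anisotropic
vector in its orthogonal complement. -/
theorem exists_anisotropic_orthogonal [FiniteDimensional K W] (hQ : Q.Nondegenerate)
    {s : Finset W} (hs : s.card < finrank K W)
    (ho : ∀ x ∈ s, ∀ y ∈ s, x ≠ y → QuadraticMap.polar Q x y = 0) (hq : ∀ x ∈ s, Q x ≠ 0) :
    ∃ v, Q v ≠ 0 ∧ ∀ x ∈ s, QuadraticMap.polar Q x v = 0 := by
  by_contra! hcon
  have h2 := two_ne_zero_of_invertible K
  have hX : ∀ v, (∀ x ∈ s, QuadraticMap.polar Q x v = 0) → Q v = 0 := by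
    intro v hv
    by_contra h
    obtain ⟨x, hx, hne⟩ := hcon v h
    exact hne (hv x hx)
  have hproj : ∀ v, ∀ y ∈ s, QuadraticMap.polar Q y
      (v - ∑ x ∈ s, (QuadraticMap.polar Q x v / (2 * Q x)) • x) = 0 := by
    intro v y hy
    have : QuadraticMap.polar Q y (∑ x ∈ s, (QuadraticMap.polar Q x v / (2 * Q x)) • x) =
        QuadraticMap.polar Q y v := by
      rw [← QuadraticMap.polarBilin_apply_apply, map_sum, Finset.sum_eq_single y]
      · rw [map_smul, QuadraticMap.polarBilin_apply_apply, QuadraticMap.polar_self, smul_eq_mul,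
          nsmul_eq_mul, Nat.cast_ofNat, div_mul_cancel₀ _ (mul_ne_zero h2 (hq y hy))]
      · intro x hx hxy
        rw [map_smul, QuadraticMap.polarBilin_apply_apply, ho y hy x hx hxy.symm, smul_zero]
      · exact fun h => absurd hy h
    rw [QuadraticMap.polar_sub_right, this, sub_self]
  have hzero : ∀ w, (∀ x ∈ s, QuadraticMap.polar Q x w = 0) → w = 0 := by
    intro w hw
    have hrad : w ∈ Q.radical := by
      rw [QuadraticMap.radical_eq_ker_polarBilin, LinearMap.mem_ker]
      ext v
      set p := ∑ x ∈ s, (QuadraticMap.polar Q x v / (2 * Q x)) • x with hp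
      have h1 : QuadraticMap.polar Q w p = 0 := by
        rw [hp, ← QuadraticMap.polarBilin_apply_apply, map_sum]
        refine Finset.sum_eq_zero fun x hx => ?_
        rw [map_smul, QuadraticMap.polarBilin_apply_apply, QuadraticMap.polar_comm Q w, hw x hx,
          smul_zero]
      have h3 : QuadraticMap.polar Q w (v - p) = 0 := by
        have hv := hproj v
        rw [QuadraticMap.polar, hX w hw, hX (v - p) hv, hX (w + (v - p))]
        · simp
        · intro x hx
          rw [QuadraticMap.polar_add_right, hw x hx, hv x hx, add_zero]
      rw [QuadraticMap.polar_sub_right, h1, sub_zero] at h3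
      simpa using h3
    rw [hQ.radical_eq_bot] at hrad
    exact (Submodule.mem_bot K).1 hrad
  have htop : Submodule.span K (s : Set W) = ⊤ := by
    rw [eq_top_iff]
    intro v _
    rw [sub_eq_zero.1 (hzero _ (hproj v))]
    exact Submodule.sum_mem _ fun x hx => Submodule.smul_mem _ _ (Submodule.subset_span hx)
  have := finrank_span_finset_le_card (R := K) s
  rw [Set.finrank, htop, finrank_top] at this
  omega

/-- A finite elementary abelian `2`-subgroup of the spin group has an orthogonal basis of common
eigenvectors. -/
theorem exists_signBasis [FiniteDimensional K W] (hQ : Q.Nondegenerate)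
    {U : Subgroup (spinGroup Q)} [Finite U] (hU : ∀ u ∈ U, u ^ 2 = 1) :
    ∃ (J : Finset W) (e : Basis J K W), (Pairwise fun i j => Q.IsOrtho (e i) (e j)) ∧
      (∀ j, Q (e j) ≠ 0) ∧ ∀ j, IsSignVector (U : Set (spinGroup Q)) (e j) := by
  classical
  have hfin : (U : Set (spinGroup Q)).Finite := Set.toFinite _
  have H : ∀ k ≤ finrank K W, ∃ s : Finset W, s.card = k ∧
      (∀ x ∈ s, ∀ y ∈ s, x ≠ y → QuadraticMap.polar Q x y = 0) ∧ (∀ x ∈ s, Q x ≠ 0) ∧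
      ∀ x ∈ s, IsSignVector (U : Set (spinGroup Q)) x := by
    intro k
    induction k with
    | zero => exact fun _ => ⟨∅, by simp⟩
    | succ k ih =>
      intro hk
      obtain ⟨s, rfl, ho, hq, hs⟩ := ih (by omega)
      obtain ⟨v, hv, hvs⟩ := exists_anisotropic_orthogonal hQ hk ho hq
      obtain ⟨w, hw, hws, hwU⟩ := exists_signVector hU (X := s) hs hfin.toFinset (by simp) hv hvs
      rw [hfin.coe_toFinset] at hwU
      have hwn : w ∉ s := by
        intro h
        have := hws w h
        rw [QuadraticMap.polar_self, nsmul_eq_mul, Nat.cast_ofNat] at this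
        exact mul_ne_zero (two_ne_zero_of_invertible K) hw this
      refine ⟨insert w s, Finset.card_insert_of_notMem hwn, ?_, ?_, ?_⟩
      · intro x hx y hy hxy
        rcases Finset.mem_insert.1 hx with rfl | hx' <;>
          rcases Finset.mem_insert.1 hy with rfl | hy'
        · exact absurd rfl hxy
        · rw [QuadraticMap.polar_comm]
          exact hws y hy'
        · exact hws x hx'
        · exact ho x hx' y hy' hxy
      · intro x hx
        rcases Finset.mem_insert.1 hx with rfl | hx
        exacts [hw, hq x hx]
      · intro x hx
        rcases Finset.mem_insert.1 hx with rfl | hx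
        exacts [hwU, hs x hx]
  obtain ⟨s, hcard, ho, hq, hs⟩ := H _ le_rfl
  have ho' : Pairwise fun i j : s => Q.IsOrtho (i : W) (j : W) := fun i j hij =>
    QuadraticMap.isOrtho_polarBilin.1 (ho i i.2 j j.2 fun h => hij (Subtype.ext h))
  have hli : LinearIndependent K (fun i : s => (i : W)) := by
    refine LinearMap.BilinForm.linearIndependent_of_iIsOrtho (B := QuadraticMap.associated Q) ?_ ?_
    · exact fun i j hij => QuadraticMap.associated_isOrtho.2 (ho' hij)
    · intro i h
      exact hq i i.2 ((QuadraticMap.associated_eq_self_apply K Q (i : W)).symm.trans h)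
  refine ⟨s, basisOfLinearIndependentOfCardEqFinrank' _ hli (by simpa using hcard), ?_, ?_, ?_⟩
  · simpa using ho'
  · simpa using hq
  · simpa using hs

end Eigenbasis

/-! ### Characters of an elementary abelian group of order eight -/

/-- The group `𝔽₂³`, which labels the elements of `U/⟨z⟩` and, through the dot product, its
characters. -/
abbrev Label := Fin 3 → ZMod 2

/-- The nonzero labels: the characters that occur in the seven-dimensional representation. -/
abbrev Point := {t : Label // t ≠ 0}

/-- The sign `(-1) ^ a` of `a` in `ZMod 2`. -/
def sgn (R : Type*) [Ring R] (a : ZMod 2) : R := if a = 0 then 1 else -1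

section Sign

variable {R : Type*} [Ring R]

@[simp]
theorem sgn_zero : sgn R 0 = 1 := by simp [sgn]

theorem sgn_one : sgn R 1 = -1 := by simp [sgn]

theorem zmod_two_eq_zero_or_one (a : ZMod 2) : a = 0 ∨ a = 1 := by
  revert a
  decide

theorem sgn_add (a b : ZMod 2) : sgn R (a + b) = sgn R a * sgn R b := by
  rcases zmod_two_eq_zero_or_one a with rfl | rfl <;>
    rcases zmod_two_eq_zero_or_one b with rfl | rfl <;>
    simp [sgn_one, show (1 : ZMod 2) + 1 = 0 from rfl]

theorem sgn_eq_one_or (a : ZMod 2) : sgn R a = 1 ∨ sgn R a = -1 := by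
  rcases zmod_two_eq_zero_or_one a with rfl | rfl
  · exact Or.inl sgn_zero
  · exact Or.inr sgn_one

theorem sgn_mul_self (a : ZMod 2) : sgn R a * sgn R a = 1 := by
  rcases sgn_eq_one_or (R := R) a with h | h <;> simp [h]

theorem exists_sgn_eq {c : R} (hc : c = 1 ∨ c = -1) : ∃ a, sgn R a = c := by
  rcases hc with rfl | rfl
  exacts [⟨0, sgn_zero⟩, ⟨1, sgn_one⟩]

theorem sgn_sum {J R : Type*} [CommRing R] (s : Finset J) (f : J → ZMod 2) :
    sgn R (∑ j ∈ s, f j) = ∏ j ∈ s, sgn R (f j) := by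
  classical
  induction s using Finset.induction_on with
  | empty => simp
  | insert j s hj ih => rw [Finset.sum_insert hj, Finset.prod_insert hj, sgn_add, ih]

variable {K : Type*} [Field K] [Invertible (2 : K)]

theorem sgn_injective : Function.Injective (sgn K) := by
  have h := neg_one_ne_one_of_invertible K
  intro a b hab
  rcases zmod_two_eq_zero_or_one a with rfl | rfl <;>
    rcases zmod_two_eq_zero_or_one b with rfl | rfl <;>
    simp_all [sgn_one, eq_comm]

end Sign

theorem dotProduct_single (s : Label) (k : Fin 3) : Pi.single k 1 ⬝ᵥ s = s k := by
  simp

theorem label_eq_of_dotProduct {s s' : Label} (h : ∀ t : Point, s ⬝ᵥ t = s' ⬝ᵥ t) : s = s' := by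
  ext k
  have h' := h ⟨Pi.single k 1, by simp⟩
  simpa using h'

theorem sum_sgn_dotProduct (w : Label) : ∑ s : Label, sgn ℤ (s ⬝ᵥ w) = if w = 0 then 8 else 0 := by
  revert w
  decide

theorem label_add_eq_zero_iff (v w : Label) : v + w = 0 ↔ w = v := by
  rw [add_eq_zero_iff_eq_neg, ZModModule.neg_eq_self, eq_comm]

/-- A binary code of length seven in which the nonzero words of a parametrisation by `𝔽₂³` have
weight four is the simplex code: its coordinates are the seven nonzero linear forms. The
multiplicity of each linear form is computed by Fourier inversion. -/
theorem exists_equiv_point {J : Type*} [Fintype J] (hJ : Fintype.card J = 7) (τ : J → Label)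
    (hτ : ∀ s : Label, s ≠ 0 → ({j | s ⬝ᵥ τ j = 1} : Finset J).card = 4) :
    ∃ f : J ≃ Point, ∀ j, (f j : Label) = τ j := by
  classical
  have hrow : ∀ s : Label, ∑ j, sgn ℤ (s ⬝ᵥ τ j) = (if s = 0 then 8 else 0) - 1 := by
    intro s
    split_ifs with hs
    · subst hs
      simp [hJ]
    · have h1 : ∀ j, sgn ℤ (s ⬝ᵥ τ j) = 1 - 2 * if s ⬝ᵥ τ j = 1 then 1 else 0 := by
        intro j
        rcases zmod_two_eq_zero_or_one (s ⬝ᵥ τ j) with h | h <;> simp [h, sgn_one]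
      simp only [h1, Finset.sum_sub_distrib, ← Finset.mul_sum, Finset.sum_boole, hτ s hs]
      simp [hJ]
  have hcount : ∀ v : Label, (({j | τ j = v} : Finset J).card : ℤ) = if v = 0 then 0 else 1 := by
    intro v
    have h1 : ∑ s : Label, sgn ℤ (s ⬝ᵥ v) * ∑ j, sgn ℤ (s ⬝ᵥ τ j) =
        8 * (({j | τ j = v} : Finset J).card : ℤ) := by
      simp only [Finset.mul_sum, ← sgn_add, ← dotProduct_add]
      rw [Finset.sum_comm]
      simp only [sum_sgn_dotProduct, label_add_eq_zero_iff, Finset.card_filter, Nat.cast_sum,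
        Finset.mul_sum]
      refine Finset.sum_congr rfl fun j _ => ?_
      split_ifs <;> simp
    simp only [hrow, mul_sub, mul_one, Finset.sum_sub_distrib, mul_ite, mul_zero,
      Finset.sum_ite_eq', Finset.mem_univ, if_true, zero_dotProduct, sgn_zero,
      sum_sgn_dotProduct] at h1
    split_ifs at h1 ⊢ <;> omega
  have hne : ∀ j, τ j ≠ 0 := by
    intro j hj
    have h := hcount 0
    rw [if_pos rfl, Nat.cast_eq_zero, Finset.card_eq_zero] at h
    exact Finset.notMem_empty j (h ▸ by simp [hj])
  have hone : ∀ v : Label, v ≠ 0 → ∃ j, ({j | τ j = v} : Finset J) = {j} := by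
    intro v hv
    have h := hcount v
    rw [if_neg hv] at h
    exact Finset.card_eq_one.1 (by exact_mod_cast h)
  refine ⟨Equiv.ofBijective (fun j => (⟨τ j, hne j⟩ : Point)) ⟨fun i j hij => ?_, fun v => ?_⟩,
    fun j => rfl⟩
  · obtain ⟨k, hk⟩ := hone (τ j) (hne j)
    have hi : i ∈ ({i | τ i = τ j} : Finset J) := by simpa using congrArg Subtype.val hij
    have hj : j ∈ ({i | τ i = τ j} : Finset J) := by simp
    rw [hk, Finset.mem_singleton] at hi hj
    rw [hi, hj]
  · obtain ⟨k, hk⟩ := hone v v.2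
    have : k ∈ ({j | τ j = v} : Finset J) := by simp [hk]
    exact ⟨k, Subtype.ext (by simpa using this)⟩

/-! ### Frames of elementary abelian subgroups of rank four -/

section Frame

variable {K W : Type*} [Field K] [AddCommGroup W] [Module K W] {Q : QuadraticForm K W}

/-- The element `g` of the spin group acts on the vector `e t` with the sign `(-1) ^ (s ⬝ᵥ t)`. -/
def ActsBy (e : Point → W) (g : spinGroup Q) (s : Label) : Prop :=
  ∀ t : Point, (g : CliffordAlgebra Q) * ι Q (e t) =
    sgn K (s ⬝ᵥ (t : Label)) • (ι Q (e t) * (g : CliffordAlgebra Q))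

theorem ActsBy.mul {e : Point → W} {g h : spinGroup Q} {s s' : Label} (hg : ActsBy e g s)
    (hh : ActsBy e h s') : ActsBy e (g * h) (s + s') := fun t => by
  rw [conj_mul (hg t) (hh t), add_dotProduct, sgn_add]

theorem ActsBy.inv {e : Point → W} {g : spinGroup Q} {s : Label} (hg : ActsBy e g s) :
    ActsBy e g⁻¹ s := fun t => conj_inv (sgn_eq_one_or _) (hg t)

theorem actsBy_zero_iff {e : Point → W} {g : spinGroup Q} :
    ActsBy e g 0 ↔ ∀ t, (g : CliffordAlgebra Q) * ι Q (e t) = ι Q (e t) * g := by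
  simp [ActsBy]

/-- A frame of the subgroup `U` of the spin group: an orthogonal basis indexed by the nonzero labels
such that `U` is the group of all elements that act through one of the eight characters of the
labels. -/
structure IsFrame (U : Subgroup (spinGroup Q)) (e : Basis Point K W) : Prop where
  ortho : Pairwise fun i j => Q.IsOrtho (e i) (e j)
  ne_zero : ∀ t, Q (e t) ≠ 0
  exists_actsBy : ∀ s, ∃ u : spinGroup Q, ActsBy e u s
  mem_iff : ∀ u : spinGroup Q, u ∈ U ↔ ∃ s, ActsBy e u s

theorem IsFrame.exists_mem_actsBy {U : Subgroup (spinGroup Q)} {e : Basis Point K W}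
    (h : IsFrame U e) (s : Label) : ∃ u ∈ U, ActsBy e u s := by
  obtain ⟨u, hu⟩ := h.exists_actsBy s
  exact ⟨u, (h.mem_iff u).2 ⟨s, hu⟩, hu⟩

theorem IsFrame.basis_ne_zero {U : Subgroup (spinGroup Q)} {e : Basis Point K W}
    (h : IsFrame U e) (t : Point) : e t ≠ 0 := by
  intro h0
  apply h.ne_zero t
  rw [h0, QuadraticMap.map_zero]

variable [Invertible (2 : K)]

theorem ActsBy.unique {e : Point → W} (he : ∀ t, e t ≠ 0) {g : spinGroup Q} {s s' : Label}
    (h : ActsBy e g s) (h' : ActsBy e g s') : s = s' :=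
  label_eq_of_dotProduct fun t => sgn_injective (K := K) <|
    smul_left_injective K (ι_mul_coe_ne_zero g (he t)) ((h t).symm.trans (h' t))

theorem IsFrame.coe_eq_one_or {U : Subgroup (spinGroup Q)} {e : Basis Point K W}
    (h : IsFrame U e) {g : spinGroup Q} (hg : ActsBy e g 0) :
    (g : CliffordAlgebra Q) = 1 ∨ (g : CliffordAlgebra Q) = -1 := by
  classical
  exact coe_eq_one_or_neg_one e.span_eq h.ortho h.ne_zero (actsBy_zero_iff.1 hg)

/-- The elementary abelian subgroups of rank four that contain `-1` have frames. -/
theorem exists_isFrame (hW : finrank K W = 7) (hQ : Q.Nondegenerate) {U : Subgroup (spinGroup Q)}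
    (hU : IsElemAbTwoOfRank U 4) (hz : ContainsZ U) : ∃ e : Basis Point K W, IsFrame U e := by
  classical
  have : FiniteDimensional K W := FiniteDimensional.of_finrank_eq_succ hW
  have : Finite U := Nat.finite_of_card_ne_zero (by rw [hU.2]; norm_num)
  obtain ⟨J, e, ho, hq, hs⟩ := exists_signBasis hQ hU.1
  have hJ : Fintype.card J = 7 := by rw [← finrank_eq_card_basis e, hW]
  have he0 : ∀ j, e j ≠ 0 := fun j h0 => hq j (by rw [h0, QuadraticMap.map_zero])
  have hsgn : ∀ (u : U) (j : J), ∃ a : ZMod 2, ((u : spinGroup Q) : CliffordAlgebra Q) * ι Q (e j) =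
      sgn K a • (ι Q (e j) * (u : spinGroup Q)) := by
    intro u j
    obtain ⟨c, hc, h⟩ := hs j u u.2
    obtain ⟨a, rfl⟩ := exists_sgn_eq hc
    exact ⟨a, h⟩
  choose D hD using hsgn
  have hDuniq : ∀ (u : U) (j : J) (a : ZMod 2),
      ((u : spinGroup Q) : CliffordAlgebra Q) * ι Q (e j) =
        sgn K a • (ι Q (e j) * (u : spinGroup Q)) → D u j = a := fun u j a h =>
    sgn_injective (K := K) <|
      smul_left_injective K (ι_mul_coe_ne_zero _ (he0 j)) ((hD u j).symm.trans h)
  -- the characters of `U` in the eigenbasis, as a homomorphism to the words of length seven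
  let Φ : U →* Multiplicative (J → ZMod 2) := MonoidHom.mk' (fun u => Multiplicative.ofAdd (D u))
    (fun u v => congrArg Multiplicative.ofAdd <| funext fun j => hDuniq _ _ _ <| by
      rw [Pi.add_apply, sgn_add]
      exact conj_mul (hD u j) (hD v j))
  have hΦ : ∀ u, Φ u = Multiplicative.ofAdd (D u) := fun u => rfl
  obtain ⟨z, hzU, hz⟩ := hz
  have hz1 : z ≠ 1 := by
    rintro rfl
    have h1 : algebraMap K (CliffordAlgebra Q) (-1) = algebraMap K _ 1 := by
      rw [map_neg, map_one]
      exact hz.symm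
    exact neg_one_ne_one_of_invertible K (clifford_algebraMap_injective Q h1)
  have hker0 : ∀ u : U, D u = 0 → (u : spinGroup Q) = 1 ∨ (u : spinGroup Q) = z := by
    intro u hu
    rcases coe_eq_one_or_neg_one e.span_eq ho hq (g := (u : spinGroup Q)) (fun j => by
      simpa [hu] using hD u j) with h | h
    · exact Or.inl (Subtype.ext h)
    · exact Or.inr (Subtype.ext (h.trans hz.symm))
  have hker : Nat.card Φ.ker = 2 := by
    have h1 : (Φ.ker : Set U) = {1, ⟨z, hzU⟩} := by
      ext u
      rw [SetLike.mem_coe, MonoidHom.mem_ker, hΦ, Set.mem_insert_iff, Set.mem_singleton_iff,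
        ofAdd_eq_one]
      constructor
      · intro hu
        rcases hker0 u hu with h | h
        · exact Or.inl (Subtype.ext h)
        · exact Or.inr (Subtype.ext h)
      · rintro (rfl | rfl)
        · exact funext fun j => hDuniq _ _ _ (by simp)
        · exact funext fun j => hDuniq _ _ _ (by simp [hz])
    change Nat.card (Φ.ker : Set U) = 2
    rw [h1, Nat.card_coe_set_eq, Set.ncard_pair]
    exact fun h => hz1 (congrArg Subtype.val h).symm
  let C : Submodule (ZMod 2) (J → ZMod 2) :=
    AddSubgroup.toZModSubmodule 2 (Subgroup.toAddSubgroup' Φ.range)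
  have hC : ∀ w : J → ZMod 2, w ∈ C ↔ ∃ u, D u = w := fun w => Iff.rfl
  have hcardC : Nat.card C = 8 := by
    have h1 : Nat.card Φ.range * Nat.card Φ.ker = Nat.card U := by
      rw [← Subgroup.index_ker, Subgroup.index_mul_card]
    rw [hker, hU.2] at h1
    change Nat.card Φ.range = 8
    omega
  have hfinC : finrank (ZMod 2) C = 3 := by
    have h1 := Module.natCard_eq_pow_finrank (K := ZMod 2) (V := C)
    rw [hcardC, Nat.card_zmod] at h1
    exact (Nat.pow_right_injective le_rfl (show 2 ^ 3 = _ from h1)).symm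
  let L : Label ≃ₗ[ZMod 2] C := (finBasisOfFinrankEq (ZMod 2) C hfinC).equivFun.symm
  let τ : J → Label := fun j k => (L (Pi.single k 1) : J → ZMod 2) j
  have hL : ∀ s j, (L s : J → ZMod 2) j = s ⬝ᵥ τ j := by
    intro s j
    have h1 := LinearMap.pi_apply_eq_sum_univ (LinearMap.proj j ∘ₗ C.subtype ∘ₗ L.toLinearMap) s
    simp only [LinearMap.comp_apply, LinearEquiv.coe_coe, Submodule.subtype_apply,
      LinearMap.proj_apply, smul_eq_mul] at h1
    rw [h1]
    refine Finset.sum_congr rfl fun k _ => ?_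
    have h2 : (fun i => if k = i then 1 else 0 : Label) = Pi.single k 1 := by
      ext i
      simp [Pi.single_apply, eq_comm]
    rw [h2]
  have hτ : ∀ s : Label, s ≠ 0 → ({j | s ⬝ᵥ τ j = 1} : Finset J).card = 4 := by
    intro s hs0
    obtain ⟨u, hu⟩ := (hC _).1 (L s).2
    have hu' : ∀ j, D u j = s ⬝ᵥ τ j := fun j => by rw [hu, hL]
    have hset : ({j | sgn K (D u j) = -1} : Finset J) = ({j | s ⬝ᵥ τ j = 1} : Finset J) := by
      ext j
      rw [Finset.mem_filter_univ, Finset.mem_filter_univ, ← sgn_one, sgn_injective.eq_iff, hu']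
    have h4 := four_dvd_card_of_mul_self e.span_eq ho hq (fun j => sgn_eq_one_or (D u j))
      (g := (u : spinGroup Q)) (by rw [← pow_two, hU.1 u u.2]) (hD u)
    rw [hset] at h4
    have hle := Finset.card_le_univ ({j | s ⬝ᵥ τ j = 1} : Finset J)
    rw [hJ] at hle
    have hne : ({j | s ⬝ᵥ τ j = 1} : Finset J).card ≠ 0 := by
      intro h0
      rw [Finset.card_eq_zero, Finset.filter_eq_empty_iff] at h0
      apply hs0
      rw [← L.map_eq_zero_iff]
      refine Subtype.ext (funext fun j => ?_)
      rw [hL]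
      exact (zmod_two_eq_zero_or_one _).resolve_right (h0 (Finset.mem_univ j))
    omega
  obtain ⟨f, hf⟩ := exists_equiv_point hJ τ hτ
  have hfs : ∀ t, τ (f.symm t) = t := fun t => by rw [← hf, f.apply_symm_apply]
  have hacts : ∀ (u : U) (s : Label), D u = L s → ActsBy (e.reindex f) (u : spinGroup Q) s := by
    intro u s hus t
    rw [Basis.reindex_apply, hD, hus, hL, hfs]
  have hex : ∀ s : Label, ∃ u : U, ActsBy (e.reindex f) (u : spinGroup Q) s := by
    intro s
    obtain ⟨u, hu⟩ := (hC _).1 (L s).2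
    exact ⟨u, hacts u s hu⟩
  have hof : Pairwise fun i j => Q.IsOrtho (e.reindex f i) (e.reindex f j) := by
    intro i j hij
    simp only [Basis.reindex_apply]
    exact ho fun h => hij (f.symm.injective h)
  have hqf : ∀ t, Q (e.reindex f t) ≠ 0 := fun t => by
    rw [Basis.reindex_apply]
    exact hq _
  refine ⟨e.reindex f, hof, hqf, fun s => ?_, fun u => ⟨fun hu => ?_, ?_⟩⟩
  · obtain ⟨u, hu⟩ := hex s
    exact ⟨u, hu⟩
  · refine ⟨L.symm ⟨D ⟨u, hu⟩, (hC _).2 ⟨_, rfl⟩⟩, hacts ⟨u, hu⟩ _ ?_⟩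
    rw [L.apply_symm_apply]
  · rintro ⟨s, hus⟩
    obtain ⟨v, hv⟩ := hex s
    have h0 := hus.mul hv.inv
    rw [ZModModule.add_self, actsBy_zero_iff] at h0
    have h1 : u * (v : spinGroup Q)⁻¹ ∈ U := by
      rcases coe_eq_one_or_neg_one (e.reindex f).span_eq hof hqf h0 with h | h
      · have : u * (v : spinGroup Q)⁻¹ = 1 := Subtype.ext h
        rw [this]
        exact U.one_mem
      · have : u * (v : spinGroup Q)⁻¹ = z := Subtype.ext (h.trans hz.symm)
        rw [this]
        exact hzU
    simpa using U.mul_mem h1 v.2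

end Frame

/-! ### Discriminants of eigenlines and types of subgroups -/

theorem exists_dotProduct_of_additive (f : Label → ZMod 2)
    (hf : ∀ s s', f (s + s') = f s + f s') : ∃ x : Label, ∀ s, f s = x ⬝ᵥ s := by
  let g : Label →ₗ[ZMod 2] ZMod 2 := (AddMonoidHom.mk' f hf).toZModLinearMap 2
  refine ⟨fun k => g fun j => if k = j then 1 else 0, fun s => ?_⟩
  rw [dotProduct_comm]
  exact LinearMap.pi_apply_eq_sum_univ g s

theorem exists_plane {a b : Label} (ha : a ≠ 0) (hb : b ≠ 0) (hab : a ≠ b) :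
    ∃ s : Label, ({t | s ⬝ᵥ t = 0} : Finset Label) = {0, a, b, a + b} := by
  revert a b
  decide

theorem eq_zero_or_eq_of_dotProduct {t w : Label}
    (h : ∀ s, t ⬝ᵥ s = 0 → s ⬝ᵥ w = 0) : w = 0 ∨ w = t := by
  revert t w
  decide

/-- A word of length seven that is orthogonal to the simplex code and to the all-one word lies in
the simplex code. -/
theorem exists_dotProduct_of_sum_eq_zero (d : Point → ZMod 2) (hd : ∑ t, d t = 0)
    (hs : ∀ s : Label, ∑ t : Point, (if s ⬝ᵥ (t : Label) = 1 then d t else 0) = 0) :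
    ∃ x : Label, ∀ t : Point, d t = x ⬝ᵥ (t : Label) := by
  let f : Label → ZMod 2 := fun t => if h : t ≠ 0 then d ⟨t, h⟩ else 0
  have hf : ∀ t : Point, f t = d t := fun t => dif_pos t.2
  have hf0 : f 0 = 0 := dif_neg (by simp)
  have hplane : ∀ s : Label, ∑ t ∈ ({t | s ⬝ᵥ t = 0} : Finset Label), f t = 0 := by
    intro s
    have h1 : ∑ t, f t = 0 := by
      rw [Fintype.sum_eq_add_sum_subtype_ne f 0, hf0, zero_add]
      exact (Finset.sum_congr rfl fun t _ => hf t).trans hd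
    have h2 : ∑ t, (if s ⬝ᵥ t = 1 then f t else 0) = 0 := by
      rw [Fintype.sum_eq_add_sum_subtype_ne _ 0, hf0, ite_self, zero_add]
      exact (Finset.sum_congr rfl fun t _ => by rw [hf]).trans (hs s)
    rw [← Finset.sum_filter_add_sum_filter_not Finset.univ (fun t => s ⬝ᵥ t = 1), Finset.sum_filter,
      h2, zero_add] at h1
    refine Eq.trans ?_ h1
    refine Finset.sum_congr (Finset.filter_congr fun t _ => ?_) fun _ _ => rfl
    rcases zmod_two_eq_zero_or_one (s ⬝ᵥ t) with h | h <;> simp [h]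
  obtain ⟨x, hx⟩ := exists_dotProduct_of_additive f (by
    intro a b
    by_cases ha : a = 0
    · simp [ha, hf0]
    by_cases hb : b = 0
    · simp [hb, hf0]
    by_cases hab : a = b
    · rw [hab, ZModModule.add_self, ZModModule.add_self, hf0]
    obtain ⟨s, hs'⟩ := exists_plane ha hb hab
    have h := hplane s
    have hab0 : a + b ≠ 0 := fun h0 => hab ((label_add_eq_zero_iff a b).1 h0).symm
    rw [hs', Finset.sum_insert (by simp [Ne.symm ha, Ne.symm hb, Ne.symm hab0]),
      Finset.sum_insert (by simp [hab, hb]), Finset.sum_pair (by simpa using ha), hf0, zero_add,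
      ← add_assoc, add_eq_zero_iff_eq_neg, ZModModule.neg_eq_self] at h
    exact h.symm)
  exact ⟨x, fun t => by rw [← hf, hx]⟩

theorem isSquare_prod_iff {F J : Type*} [Field F] [Fintype F] [DecidableEq F] {A : Finset J}
    {d : J → ZMod 2} {f : J → F}
    (hf : ∀ t, f t ≠ 0) (hd : ∀ t, quadraticChar F (f t) = sgn ℤ (d t)) :
    IsSquare (∏ t ∈ A, f t) ↔ ∑ t ∈ A, d t = 0 := by
  rw [← quadraticChar_one_iff_isSquare (Finset.prod_ne_zero_iff.2 fun t _ => hf t), map_prod,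
    Finset.prod_congr rfl fun t _ => hd t, ← sgn_sum]
  rcases zmod_two_eq_zero_or_one (∑ t ∈ A, d t) with h | h <;> simp [h, sgn_one]

section Types

variable {F V : Type*} [Field F] [Invertible (2 : F)] [AddCommGroup V] [Module F V]
  {Q : QuadraticForm F V} {U : Subgroup (spinGroup Q)} {e : Basis Point F V}

/-- An eigenvector of an element that is diagonal in a basis has coordinates only at the basis
vectors with the same eigenvalue. -/
theorem ActsBy.conj_iff {e : Basis Point F V} {g : spinGroup Q} {s : Label} (hg : ActsBy e g s)
    {v : V} {c : F} : (g : CliffordAlgebra Q) * ι Q v = c • (ι Q v * (g : CliffordAlgebra Q)) ↔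
      ∀ t : Point, sgn F (s ⬝ᵥ (t : Label)) * e.repr v t = c * e.repr v t := by
  let A : V →ₗ[F] V := e.constr F fun t => sgn F (s ⬝ᵥ (t : Label)) • e t
  have hA : ∀ t, A (e t) = sgn F (s ⬝ᵥ (t : Label)) • e t := e.constr_basis F _
  have h1 : LinearMap.mulLeft F (g : CliffordAlgebra Q) ∘ₗ ι Q =
      LinearMap.mulRight F (g : CliffordAlgebra Q) ∘ₗ ι Q ∘ₗ A :=
    e.ext fun t => by
      simpa [hA] using hg t
  have h2 : ∀ t : Point, e.coord t ∘ₗ A = sgn F (s ⬝ᵥ (t : Label)) • e.coord t := fun t =>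
    e.ext fun t' => by
      simp only [LinearMap.comp_apply, hA, map_smul, LinearMap.smul_apply, Basis.coord_apply,
        Basis.repr_self, Finsupp.single_apply]
      split_ifs with htt
      · rw [htt]
      · simp
  have h1v : (g : CliffordAlgebra Q) * ι Q v = ι Q (A v) * (g : CliffordAlgebra Q) :=
    LinearMap.congr_fun h1 v
  have h2v : ∀ t : Point, e.repr (A v) t = sgn F (s ⬝ᵥ (t : Label)) * e.repr v t := fun t =>
    LinearMap.congr_fun (h2 t) v
  rw [h1v, ← smul_mul_assoc, ← map_smul]
  constructor
  · intro hv t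
    have h3 : A v = c • v := ι_injective Q (coe_mul_right_cancel _ hv)
    rw [← h2v, h3, map_smul, Finsupp.smul_apply, smul_eq_mul]
  · intro hv
    congr 2
    refine e.repr.injective (Finsupp.ext fun t => ?_)
    rw [h2v, hv, map_smul, Finsupp.smul_apply, smul_eq_mul]

/-- An eigenspace of a subgroup of `U` is spanned by the members of a frame of `U` that it
contains. -/
theorem IsFrame.eigenspace_eq_span (h : IsFrame U e) {E : Subgroup (spinGroup Q)} (hE : E ≤ U)
    (χ : E →* Fˣ) : eigenspace E χ = Submodule.span F
      (e '' {t | ∀ (g : E) (s : Label), ActsBy e (g : spinGroup Q) s →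
        (χ g : F) = sgn F (s ⬝ᵥ (t : Label))}) := by
  have hmem : ∀ v, v ∈ eigenspace E χ ↔ ∀ g : E, ((g : spinGroup Q) : CliffordAlgebra Q) * ι Q v =
      (χ g : F) • (ι Q v * (g : spinGroup Q)) := by
    refine fun v => forall_congr' fun g => ⟨fun hv => ?_, fun hv => ?_⟩
    · rw [← smul_mul_assoc, ← hv, mul_assoc, coe_inv_mul_coe, mul_one]
    · rw [hv, smul_mul_assoc, mul_assoc, coe_mul_coe_inv, mul_one]
  ext v
  rw [Basis.mem_span_image, hmem]
  constructor
  · intro hv t ht g s hg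
    exact (mul_right_cancel₀ (Finsupp.mem_support_iff.1 ht) (hg.conj_iff.1 (hv g) t)).symm
  · intro hv g
    obtain ⟨s, hs⟩ := (h.mem_iff g).1 (hE g.2)
    refine hs.conj_iff.2 fun t => ?_
    by_cases ht : e.repr v t = 0
    · simp [ht]
    · rw [hv (Finsupp.mem_support_iff.2 ht) g s hs]

theorem IsFrame.hasSquareDiscr_eigenspace_iff (h : IsFrame U e) {E : Subgroup (spinGroup Q)}
    (hE : E ≤ U) (χ : E →* Fˣ) (A : Finset Point)
    (hA : ∀ t, t ∈ A ↔ ∀ (g : E) (s : Label), ActsBy e (g : spinGroup Q) s →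
      (χ g : F) = sgn F (s ⬝ᵥ (t : Label))) :
    HasSquareDiscr (Q.restrict (eigenspace E χ)) ↔ IsSquare (∏ t ∈ A, Q (e t)) := by
  have hspan : eigenspace E χ = Submodule.span F (Set.range fun t : A => e t) := by
    rw [h.eigenspace_eq_span hE]
    congr 1
    ext v
    simp only [Set.mem_image, Set.mem_ofPred_eq, Set.mem_range, Subtype.exists, ← hA, exists_prop]
  rw [hspan]
  have hli : LinearIndependent F fun t : A => e t :=
    e.linearIndependent.comp _ Subtype.val_injective
  rw [hasSquareDiscr_iff (Basis.span hli), ← Finset.prod_coe_sort A]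
  · simp [QuadraticMap.restrict_apply]
  · intro i j hij
    have := h.ortho fun hh => hij (Subtype.ext hh)
    simpa [QuadraticMap.isOrtho_def, QuadraticMap.restrict_apply] using this

/-- The values of the form on a frame of a type I subgroup are squares, as each line of the frame is
an eigenspace. -/
theorem IsFrame.isSquare_of_isTypeI (h : IsFrame U e) (hI : IsTypeI U) (t : Point) :
    IsSquare (Q (e t)) := by
  classical
  choose l hl using fun u : U => (h.mem_iff u).1 u.2
  have hluniq : ∀ (u : U) (s : Label), ActsBy e (u : spinGroup Q) s → s = l u := fun u s hs =>
    hs.unique h.basis_ne_zero (hl u)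
  let χ : U →* Fˣ := MonoidHom.mk' (fun u => if l u ⬝ᵥ (t : Label) = 0 then 1 else -1) (by
    intro u v
    rw [← hluniq _ _ ((hl u).mul (hl v)), add_dotProduct]
    rcases zmod_two_eq_zero_or_one (l u ⬝ᵥ (t : Label)) with h1 | h1 <;>
      rcases zmod_two_eq_zero_or_one (l v ⬝ᵥ (t : Label)) with h2 | h2 <;>
      simp [h1, h2, show (1 : ZMod 2) + 1 = 0 from rfl])
  have hχ : ∀ u, (χ u : F) = sgn F (l u ⬝ᵥ (t : Label)) := by
    intro u
    simp only [χ, MonoidHom.mk'_apply, sgn]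
    split_ifs <;> simp
  have h1 := hI χ
  rwa [h.hasSquareDiscr_eigenspace_iff le_rfl χ {t}, Finset.prod_singleton] at h1
  intro t'
  rw [Finset.mem_singleton]
  constructor
  · rintro rfl u s hs
    rw [hχ, hluniq u s hs]
  · intro ht'
    refine Subtype.ext ?_
    refine label_eq_of_dotProduct fun s => ?_
    obtain ⟨u, huU, hu⟩ := h.exists_mem_actsBy s
    have h2 := ht' ⟨u, huU⟩ s hu
    rw [hχ, ← hluniq ⟨u, huU⟩ s hu] at h2
    rw [dotProduct_comm, dotProduct_comm (t : Label)]
    exact (sgn_injective h2).symm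

/-- A subgroup of index two of `U` that contains `-1` is the kernel of one of the seven characters
of `U`. -/
theorem IsFrame.exists_point_of_rank_three (h : IsFrame U e) (hU : IsElemAbTwoOfRank U 4)
    {E : Subgroup (spinGroup Q)} (hE : E ≤ U) (hE3 : IsElemAbTwoOfRank E 3) (hz : ContainsZ E) :
    ∃ p : Point, ∀ (g : spinGroup Q) (s : Label), ActsBy e g s →
      (g ∈ E ↔ (p : Label) ⬝ᵥ s = 0) := by
  classical
  obtain ⟨z, hzE, hz⟩ := hz
  have hindex : (E.subgroupOf U).index = 2 := by
    have h1 := (E.subgroupOf U).index_mul_card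
    rw [Nat.card_congr (Subgroup.subgroupOfEquivOfLe hE).toEquiv, hE3.2, hU.2] at h1
    omega
  have hmulmem : ∀ a b : spinGroup Q, a ∈ U → b ∈ U → (a * b ∈ E ↔ (a ∈ E ↔ b ∈ E)) :=
    fun a b ha hb => Subgroup.mul_mem_iff_of_index_two hindex (a := ⟨a, ha⟩) (b := ⟨b, hb⟩)
  have hsame : ∀ {g g' : spinGroup Q} {s : Label}, ActsBy e g s → ActsBy e g' s → g' ∈ E →
      g ∈ E := by
    intro g g' s hg hg' hmem
    have h0 := hg.mul hg'.inv
    rw [ZModModule.add_self] at h0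
    have h1 : g * g'⁻¹ ∈ E := by
      rcases h.coe_eq_one_or h0 with h1 | h1
      · rw [show g * g'⁻¹ = 1 from Subtype.ext h1]
        exact E.one_mem
      · rw [show g * g'⁻¹ = z from Subtype.ext (h1.trans hz.symm)]
        exact hzE
    simpa using E.mul_mem h1 hmem
  choose m hmU hm using h.exists_mem_actsBy
  obtain ⟨p, hp⟩ := exists_dotProduct_of_additive (fun s => if m s ∈ E then 0 else 1) (by
    intro s s'
    have h1 : m (s + s') ∈ E ↔ m s * m s' ∈ E :=
      ⟨hsame ((hm s).mul (hm s')) (hm _), hsame (hm _) ((hm s).mul (hm s'))⟩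
    rw [hmulmem _ _ (hmU s) (hmU s')] at h1
    by_cases hs : m s ∈ E <;> by_cases hs' : m s' ∈ E <;> simp [h1, hs, hs']
    rfl)
  have hiff : ∀ (g : spinGroup Q) (s : Label), ActsBy e g s → (g ∈ E ↔ p ⬝ᵥ s = 0) := by
    intro g s hg
    rw [← hp]
    by_cases hs : m s ∈ E
    · simp [hs, hsame hg (hm s) hs]
    · simpa [hs] using fun hgE => hs (hsame (hm s) hg hgE)
  refine ⟨⟨p, ?_⟩, hiff⟩
  rintro rfl
  have hUE : U ≤ E := fun u hu => by
    obtain ⟨s, hs⟩ := (h.mem_iff u).1 hu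
    exact (hiff u s hs).2 (zero_dotProduct s)
  have h1 := hU.2
  rw [le_antisymm hUE hE, hE3.2] at h1
  omega

variable [Fintype F] [DecidableEq F]

/-- If the form has square discriminant then the classes modulo squares of the values of the form on
a frame are given by a label: every element of `U` has spinor norm `1`, so these classes form a word
orthogonal to the simplex code. -/
theorem IsFrame.exists_quadraticChar_eq (h : IsFrame U e) (hQ : HasSquareDiscr Q) :
    ∃ x : Label, ∀ t : Point, quadraticChar F (Q (e t)) = sgn ℤ (x ⬝ᵥ (t : Label)) := by
  have hd : ∀ t, ∃ a, sgn ℤ a = quadraticChar F (Q (e t)) := fun t =>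
    exists_sgn_eq (quadraticChar_dichotomy (h.ne_zero t))
  choose d hd using hd
  obtain ⟨x, hx⟩ := exists_dotProduct_of_sum_eq_zero d
    ((isSquare_prod_iff h.ne_zero fun t => (hd t).symm).1 ((hasSquareDiscr_iff e h.ortho).1 hQ))
    (by
      intro s
      obtain ⟨u, hu⟩ := h.exists_actsBy s
      obtain ⟨c, -, -, hc⟩ := coe_eq_smul_vecProd e.span_eq h.ortho h.ne_zero
        (fun t => sgn_eq_one_or (s ⬝ᵥ (t : Label))) hu
      rw [← Finset.sum_filter, ← isSquare_prod_iff h.ne_zero fun t => (hd t).symm]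
      have hset : ({t | sgn F (s ⬝ᵥ (t : Label)) = -1} : Finset Point) =
          ({t | s ⬝ᵥ (t : Label) = 1} : Finset Point) := by
        ext t
        rw [Finset.mem_filter_univ, Finset.mem_filter_univ, ← sgn_one, sgn_injective.eq_iff]
      rw [hset] at hc
      refine ⟨c⁻¹, ?_⟩
      have hc0 : c ≠ 0 := by rintro rfl; simp at hc
      field_simp
      linear_combination hc)
  exact ⟨x, fun t => by rw [← hd, hx]⟩

/-- The type of a subgroup of rank three of `U` is detected by the element of `U` whose label gives
the classes modulo squares of the values of the form on a frame: the eigenspaces of the kernel of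
the character `p` are the line `p` and three planes spanned by pairs of lines with sum `p`. -/
theorem IsFrame.type_of_rank_three (h : IsFrame U e) (hU : IsElemAbTwoOfRank U 4) {x : Label}
    (hx : ∀ t : Point, quadraticChar F (Q (e t)) = sgn ℤ (x ⬝ᵥ (t : Label))) {g : spinGroup Q}
    (hg : ActsBy e g x) {E : Subgroup (spinGroup Q)} (hE : E ≤ U) (hE3 : IsElemAbTwoOfRank E 3)
    (hz : ContainsZ E) : (g ∈ E → IsTypeI E) ∧ (g ∉ E → IsTypeII E) := by
  classical
  obtain ⟨p, hp⟩ := h.exists_point_of_rank_three hU hE hE3 hz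
  rw [hp g x hg]
  have hmE : ∀ s, (p : Label) ⬝ᵥ s = 0 → ∃ m : E, ActsBy e (m : spinGroup Q) s := by
    intro s hs
    obtain ⟨m, -, hm⟩ := h.exists_mem_actsBy s
    exact ⟨⟨m, (hp m s hm).2 hs⟩, hm⟩
  constructor
  · intro hpx χ
    set A : Finset Point := {t | ∀ (g : E) (s : Label), ActsBy e (g : spinGroup Q) s →
      (χ g : F) = sgn F (s ⬝ᵥ (t : Label))} with hA
    rw [h.hasSquareDiscr_eigenspace_iff hE χ A (by simp [hA]), isSquare_prod_iff h.ne_zero hx]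
    rcases A.eq_empty_or_nonempty with h0 | ⟨t, ht⟩
    · simp [h0]
    · have hmem : ∀ t' : Point, t' ∈ A ↔ (t' : Label) = t ∨ (t' : Label) = t + p := by
        have hAt : ∀ t' : Point, t' ∈ A ↔ ∀ (g : E) (s : Label), ActsBy e (g : spinGroup Q) s →
            (χ g : F) = sgn F (s ⬝ᵥ (t' : Label)) := by simp [hA]
        intro t'
        constructor
        · intro ht'
          rcases eq_zero_or_eq_of_dotProduct (t := p) (w := t' + t) (by
            intro s hs
            obtain ⟨m, hm⟩ := hmE s hs
            have h1 := ((hAt t').1 ht' m s hm).symm.trans ((hAt t).1 ht m s hm)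
            rw [dotProduct_add, sgn_injective (K := F) h1, ZModModule.add_self]) with h1 | h1
          · exact Or.inl ((label_add_eq_zero_iff _ _).1 h1).symm
          · right
            rw [← h1, add_comm (t' : Label), ← add_assoc, ZModModule.add_self, zero_add]
        · intro ht'
          rw [hAt]
          intro m s hm
          rw [(hAt t).1 ht m s hm]
          rcases ht' with h1 | h1
          · rw [h1]
          · rw [h1, dotProduct_add, dotProduct_comm s p, (hp m s hm).1 m.2, add_zero]
      by_cases htp : t = p
      · have hA1 : A = {t} := by
          ext t'
          rw [hmem, Finset.mem_singleton, htp, ZModModule.add_self, Subtype.ext_iff]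
          exact or_iff_left t'.2
        rw [hA1, Finset.sum_singleton, htp, dotProduct_comm, hpx]
      · have hne : (t : Label) + p ≠ 0 := fun h0 =>
          htp (Subtype.ext ((label_add_eq_zero_iff _ _).1 h0).symm)
        have hA2 : A = {t, ⟨t + p, hne⟩} := by
          ext t'
          rw [hmem, Finset.mem_insert, Finset.mem_singleton, Subtype.ext_iff, Subtype.ext_iff]
        rw [hA2, Finset.sum_pair, dotProduct_add, ← add_assoc, ZModModule.add_self, zero_add,
          dotProduct_comm, hpx]
        intro h0
        have h1 := congrArg Subtype.val h0
        exact p.2 (by simpa using h1)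
  · intro hpx hI
    have h1 := hI 1
    rw [h.hasSquareDiscr_eigenspace_iff hE 1 {p} ?_, isSquare_prod_iff h.ne_zero hx,
      Finset.sum_singleton, dotProduct_comm] at h1
    · exact hpx h1
    · intro t
      rw [Finset.mem_singleton]
      constructor
      · rintro rfl m s hm
        rw [dotProduct_comm, (hp m s hm).1 m.2, sgn_zero]
        rfl
      · intro ht
        rcases eq_zero_or_eq_of_dotProduct (t := p) (w := t) (by
          intro s hs
          obtain ⟨m, hm⟩ := hmE s hs
          have h2 := ht m s hm
          rw [MonoidHom.one_apply, Units.val_one, ← sgn_zero (R := F)] at h2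
          exact (sgn_injective h2).symm) with h2 | h2
        · exact absurd h2 t.2
        · exact Subtype.ext h2

end Types

section Rescale

variable {K W : Type*} [Field K] [AddCommGroup W] [Module K W] {Q : QuadraticForm K W}
  {U : Subgroup (spinGroup Q)} {e : Basis Point K W}

theorem IsFrame.unitsSMul (h : IsFrame U e) (w : Point → Kˣ) : IsFrame U (e.unitsSMul w) := by
  have hact : ∀ (u : spinGroup Q) (s : Label), ActsBy (e.unitsSMul w) u s ↔ ActsBy e u s := by
    refine fun u s => forall_congr' fun t => ?_
    rw [Basis.unitsSMul_apply, Units.smul_def, map_smul, mul_smul_comm, smul_mul_assoc, smul_comm,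
      ← Units.smul_def, ← Units.smul_def, smul_left_cancel_iff]
  refine ⟨fun i j hij => ?_, fun t => ?_, fun s => ?_, fun u => ?_⟩
  · simp only [Basis.unitsSMul_apply, Units.smul_def]
    rw [← QuadraticMap.isOrtho_polarBilin, LinearMap.map_smul₂, map_smul,
      QuadraticMap.isOrtho_polarBilin.2 (h.ortho hij), smul_zero, smul_zero]
  · rw [Basis.unitsSMul_apply, Units.smul_def, QuadraticMap.map_smul]
    exact mul_ne_zero (by simp) (h.ne_zero t)
  · simpa only [hact] using h.exists_actsBy s
  · simpa only [hact] using h.mem_iff u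

end Rescale

/-! ### The normaliser of a frame -/

section MatrixAction

variable {K W : Type*} [Field K] [AddCommGroup W] [Module K W] {Q : QuadraticForm K W}

/-- The extension by zero to all labels of a family indexed by the nonzero labels. -/
def extendZero (u : Point → W) (t : Label) : W := if h : t ≠ 0 then u ⟨t, h⟩ else 0

theorem extendZero_coe (u : Point → W) (t : Point) : extendZero u t = u t := dif_pos t.2

@[simp]
theorem extendZero_zero (u : Point → W) : extendZero u 0 = 0 := dif_neg (by simp)

/-- The element `g` of the spin group permutes the vectors of the family `u` up to signs, by the
matrix `M` acting on labels. -/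
def ActsByMatrix (u : Point → W) (g : spinGroup Q) (M : Matrix (Fin 3) (Fin 3) (ZMod 2)) : Prop :=
  ∀ t : Label, ∃ c : K, (c = 1 ∨ c = -1) ∧
    (g : CliffordAlgebra Q) * ι Q (extendZero u t) =
      c • (ι Q (extendZero u (M.mulVec t)) * (g : CliffordAlgebra Q))

theorem mul_sign {c d : K} (hc : c = 1 ∨ c = -1) (hd : d = 1 ∨ d = -1) :
    c * d = 1 ∨ c * d = -1 := by
  rcases hc with rfl | rfl <;> rcases hd with rfl | rfl <;> simp

theorem ActsByMatrix.mul {u : Point → W} {g h : spinGroup Q} {M N : Matrix (Fin 3) (Fin 3) (ZMod 2)}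
    (hg : ActsByMatrix u g M) (hh : ActsByMatrix u h N) : ActsByMatrix u (g * h) (M * N) := by
  intro t
  obtain ⟨d, hd, h1⟩ := hh t
  obtain ⟨c, hc, h2⟩ := hg (N.mulVec t)
  refine ⟨c * d, mul_sign hc hd, ?_⟩
  rw [Matrix.mulVec_mulVec] at h2
  exact conj_mul h2 h1

theorem ActsByMatrix.inv_mul {u : Point → W} {g h : spinGroup Q}
    {M N : Matrix (Fin 3) (Fin 3) (ZMod 2)} (hg : ActsByMatrix u g M)
    (hh : ActsByMatrix u h (M * N)) : ActsByMatrix u (g⁻¹ * h) N := by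
  intro t
  obtain ⟨d, hd, h1⟩ := hh t
  obtain ⟨c, hc, h2⟩ := hg (N.mulVec t)
  refine ⟨c * d, mul_sign hc hd, ?_⟩
  rw [Matrix.mulVec_mulVec] at h2
  exact conj_mul (conj_inv hc h2) h1

theorem mulVec_ne_zero_of_det {M : Matrix (Fin 3) (Fin 3) (ZMod 2)} (hM : M.det ≠ 0) {t : Label}
    (ht : t ≠ 0) : M.mulVec t ≠ 0 := fun h =>
  hM (Matrix.exists_mulVec_eq_zero_iff.1 ⟨t, ht, h⟩)

variable [Invertible (2 : K)]

/-- Every invertible matrix is realised by an element of the spin group over an algebraically closed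
field. -/
theorem exists_actsByMatrix [IsAlgClosed K] {u : Point → W} (hu : ∀ t, Q (u t) = 1)
    (ho : Pairwise fun i j => Q.IsOrtho (u i) (u j)) {M : Matrix (Fin 3) (Fin 3) (ZMod 2)}
    (hM : M.det ≠ 0) : ∃ g : spinGroup Q, ActsByMatrix u g M := by
  obtain ⟨g, c, hc, hg⟩ := exists_spin_transport (Q := Q) (u := u)
    (u' := fun t => u ⟨M.mulVec t, mulVec_ne_zero_of_det hM t.2⟩) (by decide) hu (fun t => hu _) ho
    (fun i j hij => ho fun h => hij (Subtype.ext (by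
      by_contra hne
      refine mulVec_ne_zero_of_det hM (sub_ne_zero.2 hne) ?_
      rw [Matrix.mulVec_sub, sub_eq_zero]
      exact congrArg Subtype.val h)))
  refine ⟨g, fun t => ⟨c, hc, ?_⟩⟩
  by_cases ht : t = 0
  · simp [ht]
  · have h1 := hg ⟨t, ht⟩
    rwa [← extendZero_coe u, ← extendZero_coe u] at h1

/-- The normaliser of `U` permutes the lines of a frame of `U`, linearly in the labels. -/
theorem IsFrame.exists_actsByMatrix {U : Subgroup (spinGroup Q)} {e : Basis Point K W}
    (h : IsFrame U e) (he : ∀ t, Q (e t) = 1) {n : spinGroup Q}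
    (hn : ∀ u ∈ U, n⁻¹ * u * n ∈ U) :
    ∃ M : Matrix (Fin 3) (Fin 3) (ZMod 2), M.det ≠ 0 ∧ ActsByMatrix e n M := by
  choose m hmU hm using h.exists_mem_actsBy
  choose a ha using fun k : Fin 3 => (h.mem_iff _).1 (hn _ (hmU (Pi.single k 1)))
  let M : Matrix (Fin 3) (Fin 3) (ZMod 2) := Matrix.of a
  have hM : ∀ (t : Label) k, M.mulVec t k = a k ⬝ᵥ t := fun _ _ => rfl
  have key : ∀ t : Point, ∃ (r : Point) (c : K), (r : Label) = M.mulVec t ∧ (c = 1 ∨ c = -1) ∧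
      (n : CliffordAlgebra Q) * ι Q (e t) = c • (ι Q (e r) * (n : CliffordAlgebra Q)) := by
    intro t
    obtain ⟨w, hw⟩ := exists_conj_vector n (e t)
    have hQw : Q w = 1 := by rw [quadratic_eq_of_conj hw, he]
    have hact : ∀ k, (m (Pi.single k 1) : CliffordAlgebra Q) * ι Q w =
        sgn K (M.mulVec t k) • (ι Q w * (m (Pi.single k 1) : CliffordAlgebra Q)) := by
      intro k
      apply coe_mul_right_cancel n
      have h1 : (m (Pi.single k 1) : CliffordAlgebra Q) * n =
          n * (n⁻¹ * m (Pi.single k 1) * n : spinGroup Q) := by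
        rw [← coe_mul, ← coe_mul]
        congr 1
        group
      have h2 := ha k t
      rw [mul_assoc, ← hw, ← mul_assoc, h1, mul_assoc, h2, hM, mul_smul_comm, ← mul_assoc, hw,
        mul_assoc (ι Q w), ← h1, ← mul_assoc, smul_mul_assoc]
    have hsupp : ∀ r : Point, e.repr w r ≠ 0 → (r : Label) = M.mulVec t := by
      intro r hr
      ext k
      have h1 := (hm (Pi.single k 1)).conj_iff.1 (hact k) r
      rw [dotProduct_single] at h1
      exact sgn_injective (mul_right_cancel₀ hr h1)
    have hw0 : w ≠ 0 := by
      rintro rfl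
      simp at hQw
    obtain ⟨r, hr⟩ : ∃ r, e.repr w r ≠ 0 := by
      by_contra! hcon
      exact hw0 (e.repr.map_eq_zero_iff.1 (Finsupp.ext hcon))
    have hwr : w = e.repr w r • e r := by
      conv_lhs => rw [← e.sum_repr w]
      refine Finset.sum_eq_single r (fun r' _ hr' => ?_) (by simp)
      by_contra h0
      have h1 : e.repr w r' ≠ 0 := fun h1 => h0 (by rw [h1, zero_smul])
      exact hr' (Subtype.ext ((hsupp r' h1).trans (hsupp r hr).symm))
    have hc : (n : CliffordAlgebra Q) * ι Q (e t) =
        e.repr w r • (ι Q (e r) * (n : CliffordAlgebra Q)) := by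
      rw [hw, ← smul_mul_assoc, ← map_smul, ← hwr]
    exact ⟨r, _, hsupp r hr,
      eq_one_or_neg_one_of_conj (h.ne_zero t) ((he r).trans (he t).symm) hc, hc⟩
  refine ⟨M, fun hdet => ?_, fun t => ?_⟩
  · obtain ⟨t, ht, h0⟩ := Matrix.exists_mulVec_eq_zero_iff.2 hdet
    obtain ⟨r, -, hr, -⟩ := key ⟨t, ht⟩
    exact r.2 (hr.trans h0)
  · by_cases ht : t = 0
    · exact ⟨1, Or.inl rfl, by simp [ht]⟩
    · obtain ⟨r, c, hr, hc, h1⟩ := key ⟨t, ht⟩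
      refine ⟨c, hc, ?_⟩
      rwa [← extendZero_coe e r, hr, ← extendZero_coe e] at h1

end MatrixAction

/-- In `GL₃(𝔽₂)` every transvection is the square of an element of order four. -/
theorem exists_mul_self_eq_transvection (τ : Matrix.TransvectionStruct (Fin 3) (ZMod 2)) :
    ∃ θ : Matrix (Fin 3) (Fin 3) (ZMod 2), θ.det ≠ 0 ∧ θ * θ = τ.toMatrix := by
  obtain ⟨i, j, hij, c⟩ := τ
  rcases zmod_two_eq_zero_or_one c with rfl | rfl
  · exact ⟨1, by simp, by simp [Matrix.TransvectionStruct.toMatrix]⟩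
  · obtain ⟨k, hik, hkj⟩ : ∃ k, i ≠ k ∧ k ≠ j := by
      revert i j
      decide
    refine ⟨Matrix.transvection i k 1 * Matrix.transvection k j 1, ?_, ?_⟩
    · rw [Matrix.det_mul, Matrix.det_transvection_of_ne _ _ hik,
        Matrix.det_transvection_of_ne _ _ hkj]
      decide
    · change _ = Matrix.transvection i j 1
      revert i j k
      decide

/-! ### Frames over the algebraic closure and the Frobenius endomorphism -/

theorem extendZero_baseChange {F V : Type*} [Field F] [AddCommGroup V] [Module F V]
    (e : Basis Point F V) (t : Label) :
    extendZero (e.baseChange (AlgebraicClosure F)) t = 1 ⊗ₜ[F] extendZero e t := by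
  by_cases ht : t = 0
  · simp [ht]
  · simpa [Basis.baseChange_apply] using
      (extendZero_coe (e.baseChange (AlgebraicClosure F)) ⟨t, ht⟩).trans
        (by rw [Basis.baseChange_apply, ← extendZero_coe e])

section Frobenius

variable {F V : Type*} [Field F] [Invertible (2 : F)] [AddCommGroup V] [Module F V]
  {Q : QuadraticForm F V}

noncomputable instance invertibleTwoAlgebraicClosure : Invertible (2 : AlgebraicClosure F) :=
  (Invertible.map (algebraMap F (AlgebraicClosure F)) (2 : F)).copy _ (map_ofNat _ 2).symm

theorem geomForm_one_tmul (v : V) :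
    geomForm Q ((1 : AlgebraicClosure F) ⊗ₜ[F] v) = algebraMap F (AlgebraicClosure F) (Q v) := by
  rw [QuadraticForm.baseChange_tmul, mul_one, Algebra.algebraMap_eq_smul_one]

theorem isOrtho_one_tmul {v w : V} (h : Q.IsOrtho v w) :
    (geomForm Q).IsOrtho ((1 : AlgebraicClosure F) ⊗ₜ[F] v) (1 ⊗ₜ[F] w) := by
  rw [QuadraticMap.isOrtho_def, ← TensorProduct.tmul_add, geomForm_one_tmul, geomForm_one_tmul,
    geomForm_one_tmul, ← map_add, QuadraticMap.isOrtho_def.1 h]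

theorem ofBaseChangeAux_ι' (v : V) :
    CliffordAlgebra.ofBaseChangeAux (AlgebraicClosure F) Q (ι Q v) =
      ι (geomForm Q) (1 ⊗ₜ[F] v) :=
  CliffordAlgebra.ofBaseChangeAux_ι _ Q v

theorem coe_spinIncl (u : spinGroup Q) : (spinIncl Q u : CliffordAlgebra (geomForm Q)) =
    CliffordAlgebra.ofBaseChangeAux (AlgebraicClosure F) Q u := rfl

theorem ActsBy.spinIncl {e : Basis Point F V} {u : spinGroup Q} {s : Label} (h : ActsBy e u s) :
    ActsBy (e.baseChange (AlgebraicClosure F)) (spinIncl Q u) s := by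
  intro t
  have h1 := congrArg (CliffordAlgebra.ofBaseChangeAux (AlgebraicClosure F) Q) (h t)
  rw [map_mul, map_smul, map_mul, ofBaseChangeAux_ι'] at h1
  rw [Basis.baseChange_apply, coe_spinIncl, h1]
  rcases sgn_eq_one_or (R := F) (s ⬝ᵥ (t : Label)) with h2 | h2
  · have h3 : s ⬝ᵥ (t : Label) = 0 := sgn_injective (h2.trans sgn_zero.symm)
    simp [h3]
  · have h3 : s ⬝ᵥ (t : Label) = 1 := sgn_injective (h2.trans sgn_one.symm)
    simp [h3, sgn_one]

theorem IsFrame.baseChange {U : Subgroup (spinGroup Q)} {e : Basis Point F V} (h : IsFrame U e)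
    (hz : ContainsZ U) :
    IsFrame (U.map (spinIncl Q)) (e.baseChange (AlgebraicClosure F)) := by
  classical
  have ho : Pairwise fun i j => (geomForm Q).IsOrtho (e.baseChange (AlgebraicClosure F) i)
      (e.baseChange (AlgebraicClosure F) j) := by
    intro i j hij
    simp only [Basis.baseChange_apply]
    exact isOrtho_one_tmul (h.ortho hij)
  have hq : ∀ t, geomForm Q (e.baseChange (AlgebraicClosure F) t) ≠ 0 := by
    intro t
    rw [Basis.baseChange_apply, geomForm_one_tmul]
    simpa using h.ne_zero t
  refine ⟨ho, hq, fun s => ?_, fun y => ⟨?_, ?_⟩⟩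
  · obtain ⟨u, hu⟩ := h.exists_actsBy s
    exact ⟨_, hu.spinIncl⟩
  · rintro ⟨u, hu, rfl⟩
    obtain ⟨s, hs⟩ := (h.mem_iff u).1 hu
    exact ⟨s, hs.spinIncl⟩
  · rintro ⟨s, hs⟩
    obtain ⟨m, hmU, hm⟩ := h.exists_mem_actsBy s
    have h0 := hs.mul hm.spinIncl.inv
    rw [ZModModule.add_self, actsBy_zero_iff] at h0
    have hmem : y * (SpinSeven.spinIncl Q m)⁻¹ ∈ U.map (SpinSeven.spinIncl Q) := by
      rcases coe_eq_one_or_neg_one (e.baseChange (AlgebraicClosure F)).span_eq ho hq h0 with h1 | h1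
      · rw [show y * (SpinSeven.spinIncl Q m)⁻¹ = 1 from Subtype.ext h1]
        exact one_mem _
      · obtain ⟨z, hzU, hz⟩ := hz
        refine ⟨z, hzU, Subtype.ext ?_⟩
        rw [h1, coe_spinIncl, hz, map_neg, map_one]
    have := mul_mem hmem (Subgroup.mem_map_of_mem (SpinSeven.spinIncl Q) hmU)
    simpa using this

variable [Fintype F]

theorem cliffordFrob_ofBaseChangeAux (x : CliffordAlgebra Q) :
    cliffordFrob Q (CliffordAlgebra.ofBaseChangeAux (AlgebraicClosure F) Q x) =
      CliffordAlgebra.ofBaseChangeAux (AlgebraicClosure F) Q x := by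
  induction x using CliffordAlgebra.induction with
  | algebraMap r =>
    rw [AlgHom.commutes, IsScalarTower.algebraMap_apply F (AlgebraicClosure F),
      cliffordFrob_algebraMap, ← map_pow, FiniteField.pow_card]
  | ι v => rw [ofBaseChangeAux_ι', cliffordFrob_ι_tmul, one_pow]
  | mul a b ha hb => rw [map_mul, map_mul, ha, hb]
  | add a b ha hb => rw [map_add, map_add, ha, hb]

theorem spinFrob_spinIncl (u : spinGroup Q) : spinFrob Q (spinIncl Q u) = spinIncl Q u :=
  Subtype.ext (cliffordFrob_ofBaseChangeAux _)

theorem coe_spinFrob (g : spinGroup (geomForm Q)) :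
    (spinFrob Q g : CliffordAlgebra (geomForm Q)) = cliffordFrob Q g := rfl

theorem odd_card : Odd (Fintype.card F) := by
  rw [Nat.odd_iff]
  refine FiniteField.odd_card_of_char_ne_two fun h => two_ne_zero_of_invertible F ?_
  have := ringChar.Nat.cast_ringChar (R := F)
  rwa [h, Nat.cast_ofNat] at this

theorem sign_pow_card {c : AlgebraicClosure F} (hc : c = 1 ∨ c = -1) :
    c ^ Fintype.card F = c := by
  rcases hc with rfl | rfl
  · exact one_pow _
  · exact odd_card.neg_one_pow

theorem cliffordFrob_smul (c : AlgebraicClosure F) (x : CliffordAlgebra (geomForm Q)) :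
    cliffordFrob Q (c • x) = c ^ Fintype.card F • cliffordFrob Q x := by
  rw [Algebra.smul_def, map_mul, cliffordFrob_algebraMap, ← Algebra.smul_def]

theorem spinFrob_conj {g : spinGroup (geomForm Q)} {a b c : AlgebraicClosure F} {v w : V}
    (hc : c = 1 ∨ c = -1) (h : (g : CliffordAlgebra (geomForm Q)) * ι (geomForm Q) (a ⊗ₜ[F] v) =
      c • (ι (geomForm Q) (b ⊗ₜ[F] w) * (g : CliffordAlgebra (geomForm Q)))) :
    (spinFrob Q g : CliffordAlgebra (geomForm Q)) *
        ι (geomForm Q) ((a ^ Fintype.card F) ⊗ₜ[F] v) =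
      c • (ι (geomForm Q) ((b ^ Fintype.card F) ⊗ₜ[F] w) *
        (spinFrob Q g : CliffordAlgebra (geomForm Q))) := by
  have h1 := congrArg (cliffordFrob Q) h
  rwa [map_mul, cliffordFrob_smul, map_mul, cliffordFrob_ι_tmul, cliffordFrob_ι_tmul,
    sign_pow_card hc] at h1

/-! ### The normaliser of a type I subgroup is rational -/

variable {U : Subgroup (spinGroup Q)} {e : Basis Point F V}

/-- The Frobenius endomorphism fixes up to sign the elements that permute a rational frame. -/
theorem IsFrame.spinFrob_eq_or (h : IsFrame U e) (hz : ContainsZ U)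
    {n : spinGroup (geomForm Q)} {M : Matrix (Fin 3) (Fin 3) (ZMod 2)}
    (hn : ActsByMatrix (e.baseChange (AlgebraicClosure F)) n M) :
    ∃ c : AlgebraicClosure F, (c = 1 ∨ c = -1) ∧
      (spinFrob Q n : CliffordAlgebra (geomForm Q)) = c • (n : CliffordAlgebra (geomForm Q)) := by
  have h0 : ActsBy (e.baseChange (AlgebraicClosure F)) (n⁻¹ * spinFrob Q n) 0 := by
    rw [actsBy_zero_iff]
    intro t
    obtain ⟨c, hc, h1⟩ := hn t
    have h2 := h1
    rw [extendZero_baseChange, extendZero_baseChange] at h2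
    replace h2 := spinFrob_conj hc h2
    rw [one_pow, ← extendZero_baseChange, ← extendZero_baseChange] at h2
    have h3 := conj_mul (conj_inv hc h1) h2
    rwa [show c * c = 1 by rcases hc with rfl | rfl <;> simp, one_smul, extendZero_coe] at h3
  have h4 : (spinFrob Q n : CliffordAlgebra (geomForm Q)) =
      n * (n⁻¹ * spinFrob Q n : spinGroup (geomForm Q)) := by
    rw [← coe_mul, mul_inv_cancel_left]
  rcases (h.baseChange hz).coe_eq_one_or h0 with h1 | h1
  · exact ⟨1, Or.inl rfl, by rw [h4, h1, mul_one, one_smul]⟩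
  · exact ⟨-1, Or.inr rfl, by rw [h4, h1, mul_neg_one, neg_one_smul]⟩

theorem cliffordFrob_vecProd (f : Point → V) (l : List Point) :
    cliffordFrob Q (vecProd (geomForm Q) (fun t => (1 : AlgebraicClosure F) ⊗ₜ[F] f t) l) =
      vecProd (geomForm Q) (fun t => (1 : AlgebraicClosure F) ⊗ₜ[F] f t) l := by
  induction l with
  | nil => exact map_one _
  | cons j l ih => rw [vecProd_cons, map_mul, ih, cliffordFrob_ι_tmul, one_pow]

/-- The elements which are diagonal in a rational orthonormal frame are, up to sign, products of
vectors of the frame, so they are rational. -/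
theorem IsFrame.spinFrob_eq_of_one (h : IsFrame U e) (hz : ContainsZ U) (he : ∀ t, Q (e t) = 1)
    {n : spinGroup (geomForm Q)}
    (hn : ActsByMatrix (e.baseChange (AlgebraicClosure F)) n 1) : spinFrob Q n = n := by
  classical
  have h1 : ∀ t : Point, ∃ c : AlgebraicClosure F, (c = 1 ∨ c = -1) ∧
      (n : CliffordAlgebra (geomForm Q)) *
        ι (geomForm Q) (e.baseChange (AlgebraicClosure F) t) =
      c • (ι (geomForm Q) (e.baseChange (AlgebraicClosure F) t) *
        (n : CliffordAlgebra (geomForm Q))) := by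
    intro t
    have := hn t
    rwa [Matrix.one_mulVec, extendZero_coe] at this
  choose δ hδ hact using h1
  have hK := h.baseChange hz
  obtain ⟨c, hc, -, hcc⟩ := coe_eq_smul_vecProd (Basis.span_eq _) hK.ortho hK.ne_zero hδ hact
  have he' : ∀ t, geomForm Q (e.baseChange (AlgebraicClosure F) t) = 1 := fun t => by
    rw [Basis.baseChange_apply, geomForm_one_tmul, he, map_one]
  rw [Finset.prod_eq_one fun t _ => he' t, mul_one, mul_self_eq_one_iff] at hcc
  have hfun : (e.baseChange (AlgebraicClosure F) : Point → _) = fun t => 1 ⊗ₜ[F] e t :=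
    funext fun t => Basis.baseChange_apply _ _ _
  refine Subtype.ext ?_
  rw [coe_spinFrob, hc, cliffordFrob_smul, hfun, cliffordFrob_vecProd, sign_pow_card hcc]

/-- The normaliser of a rational orthonormal frame is rational. The sign by which the Frobenius
endomorphism changes an element is multiplicative, so it is trivial on squares, and `GL₃(𝔽₂)` is
generated by squares. -/
theorem IsFrame.spinFrob_eq (h : IsFrame U e) (hz : ContainsZ U) (he : ∀ t, Q (e t) = 1)
    {M : Matrix (Fin 3) (Fin 3) (ZMod 2)} (hM : M.det ≠ 0) :
    ∀ n : spinGroup (geomForm Q), ActsByMatrix (e.baseChange (AlgebraicClosure F)) n M →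
      spinFrob Q n = n := by
  have hK := h.baseChange hz
  have he' : ∀ t, geomForm Q (e.baseChange (AlgebraicClosure F) t) = 1 := fun t => by
    rw [Basis.baseChange_apply, geomForm_one_tmul, he, map_one]
  have hlift := fun (N : Matrix (Fin 3) (Fin 3) (ZMod 2)) (hN : N.det ≠ 0) =>
    SpinSeven.exists_actsByMatrix he' hK.ortho hN
  have hcancel : ∀ {a b : spinGroup (geomForm Q)}, spinFrob Q a = a →
      spinFrob Q (a⁻¹ * b) = a⁻¹ * b → spinFrob Q b = b := by
    intro a b ha hab
    rw [map_mul, map_inv, ha] at hab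
    exact mul_left_cancel hab
  refine Matrix.diagonal_transvection_induction_of_det_ne_zero
    (fun M => ∀ n : spinGroup (geomForm Q),
      ActsByMatrix (e.baseChange (AlgebraicClosure F)) n M → spinFrob Q n = n) M hM ?_ ?_ ?_
  · intro D hD
    have hD1 : Matrix.diagonal D = 1 := by
      rw [← Matrix.diagonal_one]
      congr 1
      ext i
      rw [Matrix.det_diagonal, Finset.prod_ne_zero_iff] at hD
      exact (zmod_two_eq_zero_or_one _).resolve_left (hD i (Finset.mem_univ i))
    rw [hD1]
    exact fun n => h.spinFrob_eq_of_one hz he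
  · intro τ n hn
    obtain ⟨θ, hθ, hθτ⟩ := exists_mul_self_eq_transvection τ
    obtain ⟨m, hm⟩ := hlift θ hθ
    obtain ⟨c, hc, hmc⟩ := h.spinFrob_eq_or hz hm
    refine hcancel (a := m * m) (Subtype.ext ?_) (h.spinFrob_eq_of_one hz he
      ((hm.mul hm).inv_mul (by rwa [mul_one, hθτ])))
    rw [map_mul, coe_mul, hmc, smul_mul_smul_comm,
      show c * c = 1 by rcases hc with rfl | rfl <;> simp, one_smul, coe_mul]
  · intro A B hA _ ihA ihB n hn
    obtain ⟨m, hm⟩ := hlift A hA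
    exact hcancel (ihA m hm) (ihB _ (hm.inv_mul hn))

end Frobenius

/-! ### The invariant of an elementary abelian subgroup of rank four -/

theorem mem_conjSubgroup_iff {G : Type*} [Group G] {g y : G} {A : Subgroup G} :
    y ∈ conjSubgroup g A ↔ g⁻¹ * y * g ∈ A := by
  constructor
  · rintro ⟨a, ha, rfl⟩
    simpa [mul_assoc] using ha
  · intro h
    exact ⟨_, h, by simp [mul_assoc]⟩

theorem IsFrame.conjSubgroup_eq {K W : Type*} [Field K] [AddCommGroup W] [Module K W]
    {Q : QuadraticForm K W} {A B : Subgroup (spinGroup Q)} {f f' : Basis Point K W}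
    (hA : IsFrame A f) (hB : IsFrame B f') {g : spinGroup Q} {c : K} (hc : c = 1 ∨ c = -1)
    (hg : ∀ t, (g : CliffordAlgebra Q) * ι Q (f t) =
      c • (ι Q (f' t) * (g : CliffordAlgebra Q))) : conjSubgroup g A = B := by
  have hcc : ∀ d : K, c * (d * c) = d := by
    intro d
    rcases hc with rfl | rfl <;> ring
  have hcc' : ∀ d : K, c * d * c = d := by
    intro d
    rcases hc with rfl | rfl <;> ring
  ext y
  rw [mem_conjSubgroup_iff, hA.mem_iff, hB.mem_iff]
  refine exists_congr fun s => ⟨fun h t => ?_, fun h t => ?_⟩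
  · have h1 := conj_mul (conj_mul (hg t) (h t)) (conj_inv hc (hg t))
    rwa [hcc', show g * (g⁻¹ * y * g) * g⁻¹ = y by group] at h1
  · have h1 := conj_mul (conj_mul (conj_inv hc (hg t)) (h t)) (hg t)
    rwa [hcc'] at h1

section Invariant

variable {F V : Type*} [Field F] [Fintype F] [Invertible (2 : F)] [AddCommGroup V] [Module F V]
  {Q : QuadraticForm F V}

/-- The Frobenius map multiplies a square root of `a ∈ F` by the quadratic character of `a`. -/
theorem inv_sqrt_pow_card [DecidableEq F] {a : F} {r : AlgebraicClosure F} {d : ZMod 2}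
    (ha : a ≠ 0) (hr : algebraMap F (AlgebraicClosure F) a = r * r)
    (hd : quadraticChar F a = sgn ℤ d) :
    r⁻¹ ^ Fintype.card F = sgn (AlgebraicClosure F) d * r⁻¹ := by
  have hchar : ringChar F ≠ 2 := fun h => two_ne_zero_of_invertible F (by
    have := ringChar.Nat.cast_ringChar (R := F)
    rwa [h, Nat.cast_ofNat] at this)
  have h1 : a ^ (Fintype.card F / 2) = sgn F d := by
    rw [← quadraticChar_eq_pow_of_char_ne_two' hchar, hd]
    rcases zmod_two_eq_zero_or_one d with rfl | rfl <;> simp [sgn_one]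
  have h2 : (r * r) ^ (Fintype.card F / 2) = sgn (AlgebraicClosure F) d := by
    rw [← hr, ← map_pow, h1]
    rcases zmod_two_eq_zero_or_one d with rfl | rfl <;> simp [sgn_one]
  have hr0 : r ≠ 0 := by
    rintro rfl
    simp [ha] at hr
  have h3 : Fintype.card F = 2 * (Fintype.card F / 2) + 1 := by
    have := Nat.odd_iff.1 (odd_card (F := F))
    omega
  rw [inv_pow, h3, pow_succ, pow_mul, pow_two, h2, mul_inv]
  rcases sgn_eq_one_or (R := AlgebraicClosure F) d with h | h <;> rw [h] <;> norm_num

/-- Two elementary abelian subgroups `U`, `U₀`, the second with an orthonormal frame, become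
conjugate over the algebraic closure by an element `g` such that `g⁻¹ ψ(g)` is the element of `U`
whose label gives the classes modulo squares of the values of the form on a frame of `U`. -/
theorem IsFrame.exists_conj [DecidableEq F] {U U₀ : Subgroup (spinGroup Q)}
    {e e₀ : Basis Point F V} (h : IsFrame U e) (h₀ : IsFrame U₀ e₀) (hz : ContainsZ U)
    (hz₀ : ContainsZ U₀) (he₀ : ∀ t, Q (e₀ t) = 1) {ξ : Label}
    (hξ : ∀ t : Point, quadraticChar F (Q (e t)) = sgn ℤ (ξ ⬝ᵥ (t : Label))) :
    ∃ (g : spinGroup (geomForm Q)) (x : spinGroup Q), x ∈ U ∧ ActsBy e x ξ ∧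
      conjSubgroup g (U.map (spinIncl Q)) = U₀.map (spinIncl Q) ∧
      g⁻¹ * spinFrob Q g = spinIncl Q x := by
  choose r hr using fun t => IsAlgClosed.exists_eq_mul_self
    (algebraMap F (AlgebraicClosure F) (Q (e t)))
  have hr0 : ∀ t, r t ≠ 0 := by
    intro t h0
    have := hr t
    rw [h0, mul_zero, map_eq_zero] at this
    exact h.ne_zero t this
  set f := (e.baseChange (AlgebraicClosure F)).unitsSMul fun t => (Units.mk0 (r t) (hr0 t))⁻¹
    with hf
  have hft : ∀ t, f t = (r t)⁻¹ ⊗ₜ[F] e t := by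
    intro t
    rw [hf, Basis.unitsSMul_apply, Basis.baseChange_apply, Units.smul_def, TensorProduct.smul_tmul',
      smul_eq_mul, mul_one, Units.val_inv_eq_inv_val, Units.val_mk0]
  have hK := h.baseChange hz
  have hfK : IsFrame (U.map (spinIncl Q)) f := hK.unitsSMul _
  have h₀K := h₀.baseChange hz₀
  have hfQ : ∀ t, geomForm Q (f t) = 1 := by
    intro t
    have := hr0 t
    rw [hft, QuadraticForm.baseChange_tmul, Algebra.smul_def, hr]
    field_simp
  have h₀Q : ∀ t, geomForm Q (e₀.baseChange (AlgebraicClosure F) t) = 1 := fun t => by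
    rw [Basis.baseChange_apply, geomForm_one_tmul, he₀, map_one]
  obtain ⟨g, c, hc, hg⟩ := exists_spin_transport (by decide) hfQ h₀Q hfK.ortho h₀K.ortho
  have hψ : ActsBy f (g⁻¹ * spinFrob Q g) ξ := by
    intro t
    have h1 := hg t
    rw [hft, Basis.baseChange_apply] at h1
    replace h1 := spinFrob_conj hc h1
    rw [inv_sqrt_pow_card (h.ne_zero t) (hr t) (hξ t),
      ← smul_eq_mul (sgn (AlgebraicClosure F) (ξ ⬝ᵥ (t : Label))) (r t)⁻¹,
      ← TensorProduct.smul_tmul', ← hft, one_pow, ← Basis.baseChange_apply, map_smul,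
      mul_smul_comm] at h1
    have h2 := congrArg (sgn (AlgebraicClosure F) (ξ ⬝ᵥ (t : Label)) • ·) h1
    simp only [smul_smul, sgn_mul_self, one_smul] at h2
    have h3 := conj_mul (conj_inv hc (hg t)) h2
    rwa [mul_left_comm, show c * c = 1 by rcases hc with rfl | rfl <;> simp, mul_one] at h3
  obtain ⟨x, hxU, hx⟩ := (hfK.mem_iff _).2 ⟨ξ, hψ⟩
  refine ⟨g, x, hxU, ?_, hfK.conjSubgroup_eq h₀K hc hg, hx.symm⟩
  obtain ⟨s, hs⟩ := (h.mem_iff x).1 hxU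
  have hs' : ActsBy f (spinIncl Q x) s := by
    intro t
    have h1 := hs.spinIncl t
    rw [Basis.baseChange_apply] at h1
    have h2 := congrArg ((r t)⁻¹ • ·) h1
    rw [hft, show (r t)⁻¹ ⊗ₜ[F] e t = (r t)⁻¹ • ((1 : AlgebraicClosure F) ⊗ₜ[F] e t) by
      rw [TensorProduct.smul_tmul', smul_eq_mul, mul_one], map_smul, mul_smul_comm, smul_mul_assoc,
      smul_comm _ (r t)⁻¹]
    exact h2
  rw [hx] at hs'
  rwa [hs'.unique hfK.basis_ne_zero hψ] at hs

end Invariant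

end SpinSeven

theorem lemma1 {F : Type*} [Field F] [Fintype F] [Invertible (2 : F)]
    {V : Type*} [AddCommGroup V] [Module F V] (hV : Module.finrank F V = 7)
    (Q : QuadraticForm F V) (hQ : Q.Nondegenerate) (hdiscr : SpinSeven.HasSquareDiscr Q)
    (S : Sylow 2 (spinGroup Q))
    (U₀ : Subgroup (spinGroup Q)) (hU₀ : U₀ ∈ SpinSeven.elemAbI S 4)
    (U : Subgroup (spinGroup Q))
    (hU : U ∈ SpinSeven.elemAbIb S U₀ ∪ SpinSeven.elemAbII S 4) :
    ∃ x ∈ U, SpinSeven.IsInvariant S U₀ U x ∧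
      ∀ E : Subgroup (spinGroup Q), E ≤ U → SpinSeven.IsElemAbTwoOfRank E 3 →
        SpinSeven.ContainsZ E →
          (x ∈ E → SpinSeven.IsTypeI E) ∧ (x ∉ E → SpinSeven.IsTypeII E) := by
  classical
  obtain ⟨-, hU4, hz⟩ : U ∈ SpinSeven.elemAb S 4 := by
    rcases hU with hU | hU
    exacts [hU.1.1, hU.1]
  obtain ⟨⟨hU₀S, hU₀4, hz₀⟩, hI⟩ := hU₀
  obtain ⟨e, he⟩ := SpinSeven.exists_isFrame hV hQ hU4 hz
  obtain ⟨e₁, he₁⟩ := SpinSeven.exists_isFrame hV hQ hU₀4 hz₀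
  -- a frame of the type I subgroup `U₀` can be normalised over the ground field
  choose r hr using he₁.isSquare_of_isTypeI hI
  have hr0 : ∀ t, r t ≠ 0 := fun t h0 => he₁.ne_zero t (by rw [hr, h0, mul_zero])
  have he₀ := he₁.unitsSMul fun t => (Units.mk0 (r t) (hr0 t))⁻¹
  set e₀ := e₁.unitsSMul fun t => (Units.mk0 (r t) (hr0 t))⁻¹ with he₀def
  have he₀Q : ∀ t, Q (e₀ t) = 1 := by
    intro t
    have := hr0 t
    rw [he₀def, Module.Basis.unitsSMul_apply, Units.smul_def, QuadraticMap.map_smul, hr,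
      Units.val_inv_eq_inv_val, Units.val_mk0, smul_eq_mul]
    field_simp
  obtain ⟨ξ, hξ⟩ := he.exists_quadraticChar_eq hdiscr
  obtain ⟨g₀, x, hxU, hxξ, hconj, hx⟩ := he.exists_conj he₀ hz hz₀ he₀Q hξ
  refine ⟨x, hxU, ⟨⟨g₀, U₀, ⟨⟨⟨hU₀S, hU₀4, hz₀⟩, hI⟩, 1, ?_⟩, hconj⟩, ?_⟩, fun E hE hE3 hzE =>
    he.type_of_rank_three hU4 hξ hxξ hE hE3 hzE⟩
  · ext y
    simp [SpinSeven.mem_conjSubgroup_iff]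
  · rintro g ⟨U', ⟨-, h, rfl⟩, hg⟩
    -- `g` and `g₀` differ by a rational element and an element of the normaliser of `U₀`
    set n := (SpinSeven.spinIncl Q h)⁻¹ * g * g₀⁻¹ with hn
    have hnorm : ∀ y ∈ U₀.map (SpinSeven.spinIncl Q),
        n⁻¹ * y * n ∈ U₀.map (SpinSeven.spinIncl Q) := by
      rintro _ ⟨y, hy, rfl⟩
      have h1 : SpinSeven.spinIncl Q (h * y * h⁻¹) ∈
          SpinSeven.conjSubgroup g (U.map (SpinSeven.spinIncl Q)) := by
        rw [hg]
        exact Subgroup.mem_map_of_mem _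
          (SpinSeven.mem_conjSubgroup_iff.2 (by simpa [mul_assoc] using hy))
      rw [SpinSeven.mem_conjSubgroup_iff] at h1
      rw [← hconj, SpinSeven.mem_conjSubgroup_iff]
      convert h1 using 1
      simp only [hn, map_mul, map_inv]
      group
    obtain ⟨M, hM, hnM⟩ := (he₀.baseChange hz₀).exists_actsByMatrix (fun t => by
      rw [Module.Basis.baseChange_apply, SpinSeven.geomForm_one_tmul, he₀Q, map_one]) hnorm
    have hψn := he₀.spinFrob_eq hz₀ he₀Q hM n hnM
    have hg' : g = SpinSeven.spinIncl Q h * n * g₀ := by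
      rw [hn]
      group
    rw [hg', map_mul, map_mul, hψn, SpinSeven.spinFrob_spinIncl, ← hx]
    group
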